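/- For a simple graph $G$ on $\{1,\dots,n\}$ the graph state $|G\rangle$ is the $n$-qubit state, unique up to a scalar, that is fixed by the operators $X_v\otimes\bigotimes_{w\in N_G(v)}Z_w$ for all vertices $v$. Consider adaptive quantum algorithms consisting of single-qubit Clifford operations, two-qubit Clifford operations and measurements of qubits in the computational basis, where measured qubits are discarded and later operations may depend on earlier measurement outcomes. The CZ-complexity of such an algorithm is the maximum, over the measurement outcomes, of the number of two-qubit Clifford operations, and $\Gamma_{\mathrm{CZ}}(|G\rangle)$ is the minimum CZ-complexity of an algorithm that generates $|G\rangle$ from $|0\rangle^{\otimes(n+s)}$ with probability $1$ for some $s\ge 0$. For a set $S$ of vertices of a graph $G$ with vertex set $V$, the cut-rank of $S$ is the rank over $\mathbb{F}_2$ of the bipartite adjacency matrix between $S$ and $V\setminus S$. A rank-decomposition of $G$ is a tree with at least two vertices and maximum degree at most $3$, together with a bijection from $V$ to its leaves; its width is the maximum, over its edges $e$, of the cut-rank of either part of the partition of $V$ given by the two components of the tree without $e$. The rank-width of $G$ is the minimum width of a rank-decomposition, and is $0$ if $G$ has at most one vertex. There is an absolute constant $c>0$ such that for all integers $n\ge 2$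 and $0\le r\le\lceil n/3\rceil$ there is an $n$-vertex graph $G$ of rank-width at most $r$ with $$\Gamma_{\mathrm{CZ}}(|G\rangle)\ \ge\ \frac{c\,r\,n}{\log n},$$ where $\log$ is the natural logarithm. -/

import Mathlib

noncomputable section

namespace GraphStatePrep

/-! ### Pauli and Clifford operators

A system of qubits indexed by a finite type `ι` has computational basis `ι → Fin 2`; its operators
are the matrices indexed by `ι → Fin 2`. -/

/-- The Pauli matrix `X`. -/
def pauliX : Matrix (Fin 2) (Fin 2) ℂ := !![0, 1; 1, 0]

/-- The Pauli matrix `Y`. -/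
def pauliY : Matrix (Fin 2) (Fin 2) ℂ := !![0, -Complex.I; Complex.I, 0]

/-- The Pauli matrix `Z`. -/
def pauliZ : Matrix (Fin 2) (Fin 2) ℂ := !![1, 0; 0, -1]

/-- The tensor product of the single-qubit operators `h i`. -/
def tensor {ι : Type} [Fintype ι] (h : ι → Matrix (Fin 2) (Fin 2) ℂ) :
    Matrix (ι → Fin 2) (ι → Fin 2) ℂ :=
  Matrix.of fun x y => ∏ i, h i (x i) (y i)

/-- The Pauli group: all `α • ⨂ h i` with `α ∈ {1, -1, i, -i}` and `h i ∈ {I, X, Y, Z}`. -/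
def pauliGroup (ι : Type) [Fintype ι] : Set (Matrix (ι → Fin 2) (ι → Fin 2) ℂ) :=
  {M | ∃ α ∈ ({1, -1, Complex.I, -Complex.I} : Set ℂ),
    ∃ h : ι → Matrix (Fin 2) (Fin 2) ℂ,
      (∀ i, h i ∈ ({1, pauliX, pauliY, pauliZ} : Set (Matrix (Fin 2) (Fin 2) ℂ))) ∧
      M = α • tensor h}

/-- The Clifford group: the unitaries `U` with `U 𝒢 U† = 𝒢`, where `𝒢` is the Pauli group. -/
def cliffordGroup (ι : Type) [Fintype ι] [DecidableEq ι] :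
    Set (Matrix (ι → Fin 2) (ι → Fin 2) ℂ) :=
  {U | U ∈ Matrix.unitaryGroup (ι → Fin 2) ℂ ∧
    (fun P => U * P * U.conjTranspose) '' pauliGroup ι = pauliGroup ι}

/-! ### Graph states -/

/-- The operator `X_v ⊗ ⨂_{w ∈ N_G(v)} Z_w`. -/
def stabilizerGenerator {n : ℕ} (G : SimpleGraph (Fin n)) (v : Fin n) :
    Matrix (Fin n → Fin 2) (Fin n → Fin 2) ℂ :=
  open Classical in
  tensor fun w => if w = v then pauliX else if G.Adj v w then pauliZ else 1

/-- `φ` is a (not necessarily normalized) vector representing the graph state `|G⟩`: a nonzero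
vector of the line that is fixed by all stabilizer generators of `G`. -/
def IsGraphState {n : ℕ} (G : SimpleGraph (Fin n)) (φ : (Fin n → Fin 2) → ℂ) : Prop :=
  φ ≠ 0 ∧ ∀ v, (stabilizerGenerator G v).mulVec φ = φ

/-! ### Quantum algorithms with measurements and one- and two-qubit Clifford operations -/

/-- Vectors of a register of `q` qubits, in the computational basis. Vectors are not normalized. -/
abbrev State (q : ℕ) : Type := (Fin q → Fin 2) → ℂ

/-- The state `|0⟩^{⊗ q}`. -/
def zeroState (q : ℕ) : State q := Pi.single 0 1

/-- The operator `U` applied to the qubits `p 0, …, p (k - 1)` of the register.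
(`Function.extend p y x` is `x` with its values at the positions `p j` replaced by `y j`.) -/
def applyGate {k q : ℕ} (U : Matrix (Fin k → Fin 2) (Fin k → Fin 2) ℂ) (p : Fin k ↪ Fin q)
    (ψ : State q) : State q :=
  fun x => ∑ y : Fin k → Fin 2, U (x ∘ p) y * ψ (Function.extend p y x)

/-- The (unnormalized) state after outcome `b` of a measurement of qubit `i` in the computational
basis. The outcome has positive probability iff this vector is nonzero. -/
def project {q : ℕ} (i : Fin q) (b : Fin 2) (ψ : State q) : State q :=
  fun x => if x i = b then ψ x else 0

/-- Adaptive algorithms on a register of `q` qubits with an `n`-qubit output: decision trees that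
branch on the measurement outcomes. A leaf names the qubit that carries each output qubit. -/
inductive Algorithm (n q : ℕ) : Type
  | output (e : Fin n ↪ Fin q) : Algorithm n q
  | single (U : cliffordGroup (Fin 1)) (p : Fin 1 ↪ Fin q) (next : Algorithm n q) : Algorithm n q
  | double (U : cliffordGroup (Fin 2)) (p : Fin 2 ↪ Fin q) (next : Algorithm n q) : Algorithm n q
  | measure (i : Fin q) (next : Fin 2 → Algorithm n q) : Algorithm n q

/-- The CZ-complexity of an algorithm: the maximum, over the measurement outcomes, of the number of
two-qubit Clifford operations. -/
def Algorithm.cost {n q : ℕ} : Algorithm n q → ℕ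
  | .output _ => 0
  | .single _ _ next => next.cost
  | .double _ _ next => next.cost + 1
  | .measure _ next => max (next 0).cost (next 1).cost

/-- `A.Generates G ψ live`: started in the state `ψ` when exactly the qubits in `live` have not yet
been measured, `A` outputs `|G⟩` with probability 1. Measured qubits are discarded: no later
operation acts on them, and they are in a computational basis state `z` at the end, where the output
register has to consist of exactly the remaining qubits. Only outcomes of positive probability
matter. -/
def Algorithm.Generates {n q : ℕ} (G : SimpleGraph (Fin n)) :
    Algorithm n q → State q → Finset (Fin q) → Prop
  | .output e, ψ, live =>
      (∀ i, i ∈ live ↔ i ∈ Set.range e) ∧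
      ∃ φ : (Fin n → Fin 2) → ℂ, IsGraphState G φ ∧
      ∃ z : Fin q → Fin 2,
        (∀ x, (∀ i, i ∉ live → x i = z i) → ψ x = φ (x ∘ e)) ∧
        (∀ x, ¬ (∀ i, i ∉ live → x i = z i) → ψ x = 0)
  | .single U p next, ψ, live =>
      (∀ j, p j ∈ live) ∧ next.Generates G (applyGate U.1 p ψ) live
  | .double U p next, ψ, live =>
      (∀ j, p j ∈ live) ∧ next.Generates G (applyGate U.1 p ψ) live
  | .measure i next, ψ, live =>
      i ∈ live ∧ ∀ b, project i b ψ ≠ 0 →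
        (next b).Generates G (project i b ψ) (live.erase i)

/-- The CZ-complexity of the graph state `|G⟩`: the minimum CZ-complexity of an algorithm that
generates `|G⟩` from `|0⟩^{⊗ (n + s)}` with probability 1, for some `s ≥ 0`. -/
def czComplexity {n : ℕ} (G : SimpleGraph (Fin n)) : ℕ :=
  sInf {t | ∃ (s : ℕ) (A : Algorithm n (n + s)),
    A.Generates G (zeroState (n + s)) Finset.univ ∧ A.cost = t}

/-! ### Rank-width -/

/-- The cut-rank of `S`: the rank over `𝔽₂` of the bipartite adjacency matrix between `S` and its
complement. -/
def cutRank {V : Type} [Fintype V] (G : SimpleGraph V) (S : Set V) : ℕ :=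
  open Classical in
  (Matrix.of fun (s : S) (t : (Sᶜ : Set V)) => if G.Adj s t then (1 : ZMod 2) else 0).rank

/-- A rank-decomposition of a graph with vertex set `V`: a subcubic tree with at least two vertices,
and a bijection from `V` to its set of leaves. -/
structure RankDecomposition (V : Type) where
  /-- the number of vertices of the tree -/
  size : ℕ
  /-- the tree -/
  tree : SimpleGraph (Fin size)
  isTree : tree.IsTree
  two_le_size : 2 ≤ size
  subcubic : ∀ w, (tree.neighborSet w).ncard ≤ 3
  /-- the bijection onto the leaves -/
  leaf : V ≃ {w : Fin size // (tree.neighborSet w).ncard = 1}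

/-- The part of the partition of `V` determined by the tree edge `{a, b}` that lies on the side
of `a`. -/
def RankDecomposition.side {V : Type} (D : RankDecomposition V) (a b : Fin D.size) : Set V :=
  {v | (D.tree.deleteEdges {s(a, b)}).Reachable a (D.leaf v).1}

/-- The width of a rank-decomposition: the maximum of the cut-ranks over all tree edges. -/
def RankDecomposition.width {V : Type} [Fintype V] (D : RankDecomposition V)
    (G : SimpleGraph V) : ℕ :=
  open Classical in
  (Finset.univ.filter fun e : Fin D.size × Fin D.size => D.tree.Adj e.1 e.2).sup
    fun e => cutRank G (D.side e.1 e.2)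

/-- The rank-width: the minimum width of a rank-decomposition, and zero for graphs with at most one
vertex (which have no rank-decomposition). -/
def rankWidth {V : Type} [Fintype V] (G : SimpleGraph V) : ℕ :=
  if Fintype.card V ≤ 1 then 0 else sInf (Set.range fun D : RankDecomposition V => D.width G)

end GraphStatePrep

end

noncomputable section

namespace GraphStatePrep

open Matrix

/-! ### Gates on registers indexed by a finite type -/

section Gates

variable {κ ι ι' : Type}

/-! The proof counts. Fix a set `A` of `r` vertices. The bipartite graphs between `A` and its
complement number `2 ^ (r * (n - r))`, and `A` is a vertex cover of each of them. Every cut-rank is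
then at most `r` (`cutRank_le_card`), so any rank-decomposition witnesses rank-width at most `r`.

Conversely, few graph states have complexity at most `t`. Adaptivity does not help: along one branch
of outcomes of positive probability, an algorithm is a fixed circuit whose output is read off at
fixed values of the measured qubits. Single-qubit Cliffords are pushed to the end by absorbing them
into the two-qubit gates (`gate_tensor_mulVec`), and ancillas touched by no two-qubit gate
contribute only a scalar, so at most `n + 2 * t` qubits matter (`exists_small_circuit`). A Clifford
operator is determined up to a scalar by its action on the finite Pauli group
(`finiteUpToScalar_cliffordGroup`), so up to scalars there are `exp (O (n + t * log n))` such
circuits. Since a multiple of a graph state determines the graph (`IsGraphState.graph_eq`), if all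
the graphs above had complexity at most `t`, then `r * (n - r) * log 2 ≤ O (n) + O (t * log n)`.

This contradicts `t ≤ c * r * n / log n` once `r` exceeds a constant that absorbs the `O (n)` term.
For smaller positive `r` a star suffices: a vertex with a neighbour is entangled with the rest, so
some two-qubit gate must touch its qubit, whence `n ≤ 2 * czComplexity G`. -/

theorem extend_comp_embedding {α : Type} (p : κ ↪ ι) (y : κ → α) (x : ι → α) :
    Function.extend p y x ∘ p = y :=
  Function.extend_comp p.injective y x

theorem extend_of_notMem_range {α : Type} (p : κ ↪ ι) (y : κ → α) (x : ι → α) {i : ι}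
    (hi : i ∉ Set.range p) : Function.extend p y x i = x i :=
  Function.extend_apply' y x i fun ⟨a, ha⟩ => hi ⟨a, ha⟩

theorem eq_extend_of_eq_off_range {α : Type} {p : κ ↪ ι} {x w : ι → α}
    (h : ∀ i, i ∉ Set.range p → x i = w i) : w = Function.extend p (w ∘ p) x := by
  funext i
  by_cases hi : i ∈ Set.range p
  · obtain ⟨k, rfl⟩ := hi
    rw [p.injective.extend_apply]; rfl
  · rw [extend_of_notMem_range p _ _ hi, h i hi]

theorem extend_extend {α : Type} (p : κ ↪ ι) (y y' : κ → α) (x : ι → α) :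
    Function.extend p y (Function.extend p y' x) = Function.extend p y x := by
  funext i
  by_cases hi : i ∈ Set.range p
  · obtain ⟨k, rfl⟩ := hi
    rw [p.injective.extend_apply, p.injective.extend_apply]
  · rw [extend_of_notMem_range p _ _ hi, extend_of_notMem_range p _ _ hi,
      extend_of_notMem_range p _ _ hi]

/-- Used to pull a circuit back to a sub-register that contains every qubit it touches. -/
theorem exists_map_eq (g : ι' ↪ ι) {M : Type}
    (l : List (M × (κ ↪ ι))) (hl : ∀ a ∈ l, ∀ j, a.2 j ∈ Set.range g) :
    ∃ l' : List (M × (κ ↪ ι')),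
      l'.map (fun a => (a.1, a.2.trans g)) = l := by
  induction l with
  | nil => exact ⟨[], rfl⟩
  | cons a l ih =>
    obtain ⟨l', hl'⟩ := ih fun b hb => hl b (List.mem_cons_of_mem a hb)
    choose f hf using hl a List.mem_cons_self
    refine ⟨(a.1, ⟨f, fun j k hjk => a.2.injective (by rw [← hf j, ← hf k, hjk])⟩) :: l', ?_⟩
    rw [List.map_cons, hl']
    congr 1
    refine Prod.ext rfl ?_
    ext j
    exact hf j

variable [Fintype κ]

/-- The operator `U` applied to the qubits `p j` of a register indexed by `ι`. -/
def gate [DecidableEq κ] (U : Matrix (κ → Fin 2) (κ → Fin 2) ℂ) (p : κ ↪ ι)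
    (ψ : (ι → Fin 2) → ℂ) : (ι → Fin 2) → ℂ :=
  fun x => ∑ y : κ → Fin 2, U (x ∘ p) y * ψ (Function.extend p y x)

theorem gate_one [DecidableEq κ] (p : κ ↪ ι) (ψ : (ι → Fin 2) → ℂ) : gate 1 p ψ = ψ := by
  funext x
  simp only [gate, Matrix.one_apply, ite_mul, one_mul, zero_mul, Finset.sum_ite_eq,
    Finset.mem_univ, if_true]
  rw [← eq_extend_of_eq_off_range fun _ _ => rfl]

theorem gate_mul [DecidableEq κ] (U V : Matrix (κ → Fin 2) (κ → Fin 2) ℂ) (p : κ ↪ ι)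
    (ψ : (ι → Fin 2) → ℂ) : gate (U * V) p ψ = gate U p (gate V p ψ) := by
  funext x
  simp only [gate, Matrix.mul_apply, extend_extend, extend_comp_embedding, Finset.sum_mul,
    Finset.mul_sum, mul_assoc]
  exact Finset.sum_comm

theorem gate_smul [DecidableEq κ] (c d : ℂ) (U : Matrix (κ → Fin 2) (κ → Fin 2) ℂ) (p : κ ↪ ι)
    (ψ : (ι → Fin 2) → ℂ) : gate (c • U) p (d • ψ) = (c * d) • gate U p ψ := by
  funext x
  simp only [gate, Matrix.smul_apply, Pi.smul_apply, smul_eq_mul, Finset.mul_sum]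
  exact Finset.sum_congr rfl fun y _ => by ring

variable [Fintype ι] [Fintype ι']

/-- A sum over the configurations that agree with `x` off the range of `p`. -/
theorem sum_extend [DecidableEq κ] [DecidableEq ι] (p : κ ↪ ι) (x : ι → Fin 2)
    (f : (ι → Fin 2) → ℂ) (hf : ∀ w, (¬ ∀ i, i ∉ Set.range p → x i = w i) → f w = 0) :
    ∑ w, f w = ∑ y : κ → Fin 2, f (Function.extend p y x) := by
  symm
  refine Finset.sum_of_injOn (fun y => Function.extend p y x) ?_ (by simp) ?_ (by simp)
  · intro y _ y' _ h
    have h' : Function.extend p y x = Function.extend p y' x := h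
    rw [← extend_comp_embedding p y x, h', extend_comp_embedding]
  · intro w _ hw
    refine hf w fun h => hw ?_
    exact ⟨w ∘ p, by simp, (eq_extend_of_eq_off_range h).symm⟩

theorem tensor_mul [DecidableEq ι] (C D : ι → Matrix (Fin 2) (Fin 2) ℂ) :
    tensor C * tensor D = tensor fun i => C i * D i := by
  ext x y
  simp only [tensor, Matrix.mul_apply, Matrix.of_apply]
  rw [Finset.prod_univ_sum, Fintype.piFinset_univ]
  exact Finset.sum_congr rfl fun w _ => Finset.prod_mul_distrib.symm

theorem tensor_one [DecidableEq ι] :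
    tensor (fun _ : ι => (1 : Matrix (Fin 2) (Fin 2) ℂ)) = 1 := by
  ext x y
  simp only [tensor, Matrix.of_apply, Matrix.one_apply]
  rw [Finset.prod_ite_zero]
  simp [funext_iff]

theorem tensor_smul (c : ι → ℂ) (C : ι → Matrix (Fin 2) (Fin 2) ℂ) :
    tensor (fun i => c i • C i) = (∏ i, c i) • tensor C := by
  ext x y
  simp [tensor, Finset.prod_mul_distrib]

open Classical in
/-- The matrix of the operator `U` applied to the qubits `p j`. -/
def gateMatrix (U : Matrix (κ → Fin 2) (κ → Fin 2) ℂ) (p : κ ↪ ι) :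
    Matrix (ι → Fin 2) (ι → Fin 2) ℂ :=
  Matrix.of fun x w => if ∀ i, i ∉ Set.range p → x i = w i then U (x ∘ p) (w ∘ p) else 0

theorem gate_eq_mulVec [DecidableEq κ] [DecidableEq ι] (U : Matrix (κ → Fin 2) (κ → Fin 2) ℂ)
    (p : κ ↪ ι) (ψ : (ι → Fin 2) → ℂ) : gate U p ψ = gateMatrix U p *ᵥ ψ := by
  funext x
  simp only [Matrix.mulVec, dotProduct]
  rw [sum_extend p x]
  · refine Finset.sum_congr rfl fun y _ => ?_
    have h : ∀ i, i ∉ Set.range p → x i = Function.extend p y x i := fun i hi =>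
      (extend_of_notMem_range p y x hi).symm
    rw [gateMatrix, Matrix.of_apply, if_pos h, extend_comp_embedding]
  · intro w hw
    rw [gateMatrix, Matrix.of_apply, if_neg hw, zero_mul]

theorem tensor_eq_zero_of_ne {C : ι → Matrix (Fin 2) (Fin 2) ℂ} {i : ι} (hC : C i = 1)
    {x w : ι → Fin 2} (h : x i ≠ w i) : tensor C x w = 0 := by
  rw [tensor, Matrix.of_apply]
  exact Finset.prod_eq_zero (Finset.mem_univ i) (by rw [hC, Matrix.one_apply_ne h])

/-- Operators with disjoint supports commute. In each product a single intermediate configuration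
survives: one factor fixes it on the range of `p`, the other off it. -/
theorem gateMatrix_mul_tensor [DecidableEq κ] [DecidableEq ι]
    (U : Matrix (κ → Fin 2) (κ → Fin 2) ℂ) (p : κ ↪ ι) {E : ι → Matrix (Fin 2) (Fin 2) ℂ}
    (hE : ∀ j, E (p j) = 1) : gateMatrix U p * tensor E = tensor E * gateMatrix U p := by
  ext x w
  rw [Matrix.mul_apply, Matrix.mul_apply,
    Finset.sum_eq_single (Function.extend p (w ∘ p) x),
    Finset.sum_eq_single (Function.extend p (x ∘ p) w)]
  · have h1 : ∀ i, i ∉ Set.range p → x i = Function.extend p (w ∘ p) x i := fun i hi =>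
      (extend_of_notMem_range p _ x hi).symm
    have h2 : ∀ i, i ∉ Set.range p → Function.extend p (x ∘ p) w i = w i := fun i hi =>
      extend_of_notMem_range p _ w hi
    simp only [gateMatrix, Matrix.of_apply]
    rw [if_pos h1, if_pos h2, extend_comp_embedding, extend_comp_embedding, mul_comm]
    congr 1
    simp only [tensor, Matrix.of_apply]
    refine Finset.prod_congr rfl fun i _ => ?_
    by_cases hi : i ∈ Set.range p
    · obtain ⟨k, rfl⟩ := hi
      rw [p.injective.extend_apply, p.injective.extend_apply, hE]
      exact (Matrix.one_apply_eq _).trans (Matrix.one_apply_eq _).symm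
    · rw [extend_of_notMem_range p _ _ hi, extend_of_notMem_range p _ _ hi]
  · intro v _ hv
    by_cases h : ∀ i, i ∉ Set.range p → w i = v i
    · have hne : ∃ j, x (p j) ≠ v (p j) := by
        by_contra hcon
        push Not at hcon
        refine hv ?_
        rw [eq_extend_of_eq_off_range h]
        congr 1
        funext j
        exact (hcon j).symm
      obtain ⟨j, hj⟩ := hne
      rw [tensor_eq_zero_of_ne (hE j) hj, zero_mul]
    · rw [gateMatrix, Matrix.of_apply, if_neg, mul_zero]
      exact fun h' => h fun i hi => (h' i hi).symm
  · simp
  · intro v _ hv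
    by_cases h : ∀ i, i ∉ Set.range p → x i = v i
    · have hne : ∃ j, v (p j) ≠ w (p j) := by
        by_contra hcon
        push Not at hcon
        refine hv ?_
        rw [eq_extend_of_eq_off_range h]
        congr 1
        funext j
        exact hcon j
      obtain ⟨j, hj⟩ := hne
      rw [tensor_eq_zero_of_ne (hE j) hj, mul_zero]
    · rw [gateMatrix, Matrix.of_apply, if_neg h, zero_mul]
  · simp

theorem gateMatrix_tensor [DecidableEq κ] [DecidableEq ι] (D : κ → Matrix (Fin 2) (Fin 2) ℂ)
    (p : κ ↪ ι) : gateMatrix (tensor D) p = tensor (Function.extend p D 1) := by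
  ext x w
  rw [gateMatrix, Matrix.of_apply]
  split_ifs with h
  · simp only [tensor, Matrix.of_apply]
    refine Finset.prod_of_injOn p p.injective.injOn (by simp) ?_ ?_
    · intro i _ hi
      rw [Function.extend_apply' _ _ _ fun ⟨a, ha⟩ => hi ⟨a, by simp, ha⟩,
        h i fun ⟨a, ha⟩ => hi ⟨a, by simp, ha⟩]
      simp
    · intro k _
      rw [p.injective.extend_apply]
      rfl
  · push Not at h
    obtain ⟨i, hi, hxw⟩ := h
    rw [tensor_eq_zero_of_ne _ hxw]
    exact Function.extend_apply' _ _ _ fun ⟨a, ha⟩ => hi ⟨a, ha⟩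

theorem gate_tensor [DecidableEq κ] [DecidableEq ι] (D : κ → Matrix (Fin 2) (Fin 2) ℂ)
    (p : κ ↪ ι) (C : ι → Matrix (Fin 2) (Fin 2) ℂ) (χ : (ι → Fin 2) → ℂ) :
    gate (tensor D) p (tensor C *ᵥ χ) =
      tensor (fun i => Function.extend p D 1 i * C i) *ᵥ χ := by
  rw [gate_eq_mulVec, gateMatrix_tensor, Matrix.mulVec_mulVec, tensor_mul]

/-- Local operators on the qubits `p j` are absorbed into a gate on these qubits. -/
theorem gate_tensor_mulVec [DecidableEq κ] [DecidableEq ι]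
    (U : Matrix (κ → Fin 2) (κ → Fin 2) ℂ) (p : κ ↪ ι) (C : ι → Matrix (Fin 2) (Fin 2) ℂ)
    (χ : (ι → Fin 2) → ℂ) :
    gate U p (tensor C *ᵥ χ) =
      tensor (Function.extend p 1 C) *ᵥ gate (U * tensor (C ∘ p)) p χ := by
  have hE : ∀ j, Function.extend p (1 : κ → Matrix (Fin 2) (Fin 2) ℂ) C (p j) = 1 := fun j => by
    rw [p.injective.extend_apply]; rfl
  -- The factors of `C` off the range of `p` commute with the gate; those on it are absorbed.
  have hC : tensor C =
      tensor (Function.extend p 1 C) * gateMatrix (tensor (C ∘ p)) p := by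
    rw [gateMatrix_tensor, tensor_mul]
    congr 1
    funext i
    by_cases hi : i ∈ Set.range p
    · obtain ⟨k, rfl⟩ := hi
      rw [hE, p.injective.extend_apply, one_mul]; rfl
    · rw [extend_of_notMem_range p _ _ hi, extend_of_notMem_range p _ _ hi]
      exact (mul_one _).symm
  rw [gate_mul, gate_eq_mulVec, gate_eq_mulVec, gate_eq_mulVec, hC, ← Matrix.mulVec_mulVec,
    Matrix.mulVec_mulVec, gateMatrix_mul_tensor U p hE, ← Matrix.mulVec_mulVec]

/-! ### Circuits -/

/-- The state obtained from `|0⟩` by the gates of a list, the last one first. -/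
def runGates [DecidableEq κ] [DecidableEq ι] :
    List (Matrix (κ → Fin 2) (κ → Fin 2) ℂ × (κ ↪ ι)) → (ι → Fin 2) → ℂ
  | [] => Pi.single 0 1
  | g :: l => gate g.1 g.2 (runGates l)

open Classical in
/-- The state `χ` of the qubits `g j`, with all other qubits in the state `|0⟩`. -/
def pad (g : ι' ↪ ι) (χ : (ι' → Fin 2) → ℂ) : (ι → Fin 2) → ℂ :=
  fun x => if ∀ i, i ∉ Set.range g → (0 : ι → Fin 2) i = x i then χ (x ∘ g) else 0

theorem gate_pad [DecidableEq κ] (U : Matrix (κ → Fin 2) (κ → Fin 2) ℂ) (g : ι' ↪ ι)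
    (p : κ ↪ ι') (χ : (ι' → Fin 2) → ℂ) : gate U (p.trans g) (pad g χ) = pad g (gate U p χ) := by
  funext x
  have hoff : ∀ y : κ → Fin 2, ∀ i, i ∉ Set.range g →
      Function.extend (p.trans g) y x i = x i := fun y i hi =>
    extend_of_notMem_range _ _ _ fun ⟨k, hk⟩ => hi ⟨p k, hk⟩
  have hcomp : ∀ y : κ → Fin 2,
      Function.extend (p.trans g) y x ∘ g = Function.extend p y (x ∘ g) := by
    intro y
    funext i
    by_cases hi : i ∈ Set.range p
    · obtain ⟨k, rfl⟩ := hi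
      rw [p.injective.extend_apply]
      exact (p.trans g).injective.extend_apply y x k
    · rw [extend_of_notMem_range p _ _ hi]
      refine extend_of_notMem_range (p.trans g) _ _ ?_
      rintro ⟨k, hk⟩
      exact hi ⟨k, g.injective hk⟩
  by_cases h : ∀ i, i ∉ Set.range g → (0 : ι → Fin 2) i = x i
  · have h' : ∀ y : κ → Fin 2, ∀ i, i ∉ Set.range g →
        (0 : ι → Fin 2) i = Function.extend (p.trans g) y x i := fun y i hi => by
      rw [hoff y i hi, h i hi]
    simp only [gate, pad]
    rw [if_pos h]
    refine Finset.sum_congr rfl fun y _ => ?_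
    rw [if_pos (h' y), hcomp]
    rfl
  · have h' : ∀ y : κ → Fin 2, ¬ ∀ i, i ∉ Set.range g →
        (0 : ι → Fin 2) i = Function.extend (p.trans g) y x i := fun y hy =>
      h fun i hi => by rw [hy i hi, hoff y i hi]
    simp only [gate, pad]
    rw [if_neg h]
    exact Finset.sum_eq_zero fun y _ => by rw [if_neg (h' y), mul_zero]

theorem pad_zero [DecidableEq ι] [DecidableEq ι'] (g : ι' ↪ ι) :
    pad g (Pi.single 0 1) = Pi.single 0 1 := by
  funext x
  by_cases hx : x = 0
  · subst hx
    rw [pad, if_pos fun _ _ => rfl, Pi.single_eq_same]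
    exact Pi.single_eq_same (M := fun _ : ι' → Fin 2 => ℂ) 0 1
  · rw [Pi.single_eq_of_ne hx, pad]
    split_ifs with h
    · refine Pi.single_eq_of_ne (fun h0 => hx ?_) 1
      rw [eq_extend_of_eq_off_range h, h0]
      funext i
      by_cases hi : i ∈ Set.range g
      · obtain ⟨k, rfl⟩ := hi
        rw [g.injective.extend_apply]; rfl
      · rw [extend_of_notMem_range _ _ _ hi]
    · rfl

/-- The same circuit on a larger register. -/
theorem runGates_map [DecidableEq κ] [DecidableEq ι] [DecidableEq ι'] (g : ι' ↪ ι)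
    (l : List (Matrix (κ → Fin 2) (κ → Fin 2) ℂ × (κ ↪ ι'))) :
    runGates (l.map fun a => (a.1, a.2.trans g)) = pad g (runGates l) := by
  induction l with
  | nil => exact (pad_zero g).symm
  | cons a l ih =>
    rw [List.map_cons, runGates, ih, runGates]
    exact gate_pad _ _ _ _

/-- A qubit outside the range of `g` is still `|0⟩` when `C i` acts, so it splits off as the scalar
`C i (x i) 0`. This discards idle ancillas and also shows that an untouched output qubit is in a
product state. -/
theorem tensor_mulVec_pad [DecidableEq ι] [DecidableEq ι'] (g : ι' ↪ ι)
    (C : ι → Matrix (Fin 2) (Fin 2) ℂ) (χ : (ι' → Fin 2) → ℂ) (x : ι → Fin 2) :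
    (tensor C *ᵥ pad g χ) x =
      (∏ i ∈ Finset.univ.filter (fun i => ¬ ∃ j, g j = i), C i (x i) 0) *
        (tensor (C ∘ g) *ᵥ χ) (x ∘ g) := by
  simp only [Matrix.mulVec, dotProduct]
  rw [sum_extend g 0, Finset.mul_sum]
  · refine Finset.sum_congr rfl fun y _ => ?_
    rw [pad, if_pos fun i hi => (extend_of_notMem_range g y 0 hi).symm, extend_comp_embedding,
      ← mul_assoc]
    congr 1
    simp only [tensor, Matrix.of_apply]
    rw [← Finset.prod_filter_not_mul_prod_filter Finset.univ (fun i => ∃ j, g j = i)]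
    congr 1
    · refine Finset.prod_congr rfl fun i hi => ?_
      rw [extend_of_notMem_range g y 0 (Finset.mem_filter.1 hi).2]
      rfl
    · symm
      refine Finset.prod_of_injOn g g.injective.injOn ?_ ?_ ?_
      · intro i _
        simp
      · intro i hi hi'
        obtain ⟨j, hj⟩ := (Finset.mem_filter.1 hi).2
        exact absurd ⟨j, by simp, hj⟩ hi'
      · intro j _
        rw [g.injective.extend_apply]
        rfl
  · intro w hw
    rw [pad, if_neg hw, mul_zero]

end Gates

/-! ### Clifford operators -/

section Cliffords

variable {ι : Type} [Fintype ι]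

theorem pauliGroup_finite : (pauliGroup ι).Finite := by
  have h1 : ({1, -1, Complex.I, -Complex.I} : Set ℂ).Finite := by simp
  have h2 : ({1, pauliX, pauliY, pauliZ} : Set (Matrix (Fin 2) (Fin 2) ℂ)).Finite := by simp
  have h3 : {h : ι → Matrix (Fin 2) (Fin 2) ℂ |
      ∀ i, h i ∈ ({1, pauliX, pauliY, pauliZ} : Set _)}.Finite := by
    have := Set.Finite.pi' (ι := ι) (t := fun _ => ({1, pauliX, pauliY, pauliZ} : Set _))
      fun _ => h2
    exact this
  refine (h1.image2 (fun α h => α • tensor h) h3).subset ?_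
  rintro M ⟨α, hα, h, hh, rfl⟩
  exact ⟨α, hα, h, hh, rfl⟩

theorem tensor_mem_pauliGroup {h : ι → Matrix (Fin 2) (Fin 2) ℂ}
    (hh : ∀ i, h i ∈ ({1, pauliX, pauliY, pauliZ} : Set _)) : tensor h ∈ pauliGroup ι :=
  ⟨1, by simp, h, hh, (one_smul _ _).symm⟩

variable [DecidableEq ι]

theorem one_mem_cliffordGroup : 1 ∈ cliffordGroup ι := by
  refine ⟨one_mem _, ?_⟩
  simp

theorem mul_mem_cliffordGroup {U V : Matrix (ι → Fin 2) (ι → Fin 2) ℂ}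
    (hU : U ∈ cliffordGroup ι) (hV : V ∈ cliffordGroup ι) : U * V ∈ cliffordGroup ι := by
  refine ⟨mul_mem hU.1 hV.1, ?_⟩
  conv_rhs => rw [← hU.2, ← hV.2, Set.image_image]
  simp only [Matrix.conjTranspose_mul, Matrix.mul_assoc]

/-- A self-inverse Hermitian matrix that conjugates Pauli operators to Pauli operators. -/
theorem mem_cliffordGroup_of_involution {U : Matrix (ι → Fin 2) (ι → Fin 2) ℂ}
    (hU : U.conjTranspose = U) (hU' : U * U = 1)
    (h : ∀ P ∈ pauliGroup ι, U * P * U ∈ pauliGroup ι) : U ∈ cliffordGroup ι := by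
  refine ⟨?_, ?_⟩
  · rw [Matrix.mem_unitaryGroup_iff, Matrix.star_eq_conjTranspose, hU, hU']
  · rw [hU]
    refine Set.Subset.antisymm ?_ fun P hP => ⟨U * P * U, h P hP, ?_⟩
    · rintro _ ⟨P, hP, rfl⟩
      exact h P hP
    · calc U * (U * P * U) * U = (U * U) * P * (U * U) := by simp only [Matrix.mul_assoc]
        _ = P := by rw [hU', Matrix.one_mul, Matrix.mul_one]

theorem tensor_apply_update {h : ι → Matrix (Fin 2) (Fin 2) ℂ} {i : ι}
    (hh : ∀ j, j ≠ i → h j = 1) (x y : ι → Fin 2) :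
    tensor h x y = if y = Function.update x i (y i) then h i (x i) (y i) else 0 := by
  split_ifs with hxy
  · rw [tensor, Matrix.of_apply, Finset.prod_eq_single i]
    · intro j _ hj
      rw [hh j hj, hxy, Function.update_of_ne hj, Matrix.one_apply_eq]
    · simp
  · have : ∃ j, j ≠ i ∧ x j ≠ y j := by
      by_contra hcon
      push Not at hcon
      refine hxy ?_
      funext j
      by_cases hj : j = i
      · subst hj; simp
      · rw [Function.update_of_ne hj, hcon j hj]
    obtain ⟨j, hj, hne⟩ := this
    exact tensor_eq_zero_of_ne (hh j hj) hne

/-- An operator that commutes with all Pauli operators is a scalar. -/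
theorem eq_smul_one_of_commute {W : Matrix (ι → Fin 2) (ι → Fin 2) ℂ}
    (h : ∀ P ∈ pauliGroup ι, W * P = P * W) : ∃ c : ℂ, W = c • 1 := by
  -- Commuting with `Z` on a qubit where `x` and `y` differ forces `W x y = -W x y`.
  have hoff : ∀ x y, x ≠ y → W x y = 0 := by
    intro x y hxy
    obtain ⟨i, hi⟩ := Function.ne_iff.1 hxy
    have hd : tensor (Function.update 1 i pauliZ) =
        Matrix.diagonal fun x : ι → Fin 2 => pauliZ (x i) (x i) := by
      ext x y
      rw [tensor_apply_update (i := i) (fun j hj => by rw [Function.update_of_ne hj]; rfl)]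
      rw [Function.update_self, Matrix.diagonal_apply]
      by_cases hxy : x = y
      · subst hxy; simp
      · rw [if_neg hxy]
        split_ifs with hu
        · have : x i ≠ y i := fun he => hxy (by rw [hu, ← he, Function.update_eq_self])
          revert this
          generalize x i = a
          generalize y i = b
          fin_cases a <;> fin_cases b <;> simp [pauliZ]
        · rfl
    have hc := h (tensor (Function.update 1 i pauliZ)) (tensor_mem_pauliGroup fun j => by
      by_cases hj : j = i
      · subst hj; simp
      · rw [Function.update_of_ne hj]; simp)
    have hxy' := congrFun (congrFun hc x) y
    rw [hd, Matrix.mul_diagonal, Matrix.diagonal_mul] at hxy'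
    revert hi hxy'
    generalize x i = a
    generalize y i = b
    generalize W x y = w
    intro hi hw
    have hw2 : w = -w := by
      fin_cases a <;> fin_cases b <;> simp [pauliZ] at hi hw ⊢ <;> first | exact hw | exact hw.symm
    exact self_eq_neg.1 hw2
  -- Commuting with `X` on qubit `i` equates the diagonal entries at configurations differing only
  -- at `i`.
  have hflip : ∀ (x : ι → Fin 2) (i : ι) (b : Fin 2),
      W (Function.update x i b) (Function.update x i b) = W x x := by
    intro x i b
    by_cases hb : b = x i
    · rw [hb, Function.update_eq_self]
    have hX : ∀ x y : ι → Fin 2, tensor (Function.update 1 i pauliX) x y =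
        if y = Function.update x i (y i) then pauliX (x i) (y i) else 0 := by
      intro x y
      rw [tensor_apply_update (i := i) (fun j hj => by rw [Function.update_of_ne hj]; rfl)]
      rw [Function.update_self]
    have hc := h (tensor (Function.update 1 i pauliX)) (tensor_mem_pauliGroup fun j => by
      by_cases hj : j = i
      · subst hj; simp
      · rw [Function.update_of_ne hj]; simp)
    have hxy := congrFun (congrFun hc x) (Function.update x i b)
    rw [Matrix.mul_apply, Matrix.mul_apply, Finset.sum_eq_single x,
      Finset.sum_eq_single (Function.update x i b)] at hxy
    · rw [hX, if_pos (by simp)] at hxy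
      have h1 : pauliX (x i) (Function.update x i b i) = 1 := by
        rw [Function.update_self]
        revert hb
        generalize x i = a
        fin_cases a <;> fin_cases b <;> simp [pauliX]
      rw [h1] at hxy
      simpa using hxy.symm
    · intro v _ hv
      rw [hoff v _ hv, mul_zero]
    · simp
    · intro v _ hv
      rw [hoff x v hv.symm, zero_mul]
    · simp
  have hdiag : ∀ x : ι → Fin 2, W x x = W 0 0 := by
    intro x
    have : ∀ s : Finset ι, W (s.piecewise x 0) (s.piecewise x 0) = W 0 0 := by
      intro s
      induction s using Finset.induction_on with
      | empty => simp
      | insert i s _ ih => rw [Finset.piecewise_insert, hflip, ih]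
    simpa using this Finset.univ
  refine ⟨W 0 0, ?_⟩
  ext x y
  by_cases hxy : x = y
  · subst hxy; simp [hdiag]
  · rw [hoff x y hxy]; simp [Matrix.one_apply_ne hxy]

end Cliffords

/-! ### Finiteness of the Clifford group up to scalars -/

section FiniteUpToScalar

variable {m m' m'' : Type}

/-- A set of matrices that has finitely many elements up to scalars. -/
def FiniteUpToScalar (S : Set (Matrix m m ℂ)) : Prop :=
  ∃ F : Set (Matrix m m ℂ), F.Finite ∧ ∀ U ∈ S, ∃ c : ℂ, ∃ V ∈ F, U = c • V

theorem FiniteUpToScalar.image2 {S : Set (Matrix m m ℂ)} {T : Set (Matrix m' m' ℂ)}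
    (hS : FiniteUpToScalar S) (hT : FiniteUpToScalar T)
    (f : Matrix m m ℂ → Matrix m' m' ℂ → Matrix m'' m'' ℂ)
    (hf : ∀ (a b : ℂ) U V, f (a • U) (b • V) = (a * b) • f U V) :
    FiniteUpToScalar (Set.image2 f S T) := by
  obtain ⟨F, hF, hSF⟩ := hS
  obtain ⟨F', hF', hTF⟩ := hT
  refine ⟨Set.image2 f F F', hF.image2 f hF', ?_⟩
  rintro _ ⟨U, hU, V, hV, rfl⟩
  obtain ⟨a, U', hU', rfl⟩ := hSF U hU
  obtain ⟨b, V', hV', rfl⟩ := hTF V hV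
  exact ⟨a * b, f U' V', ⟨U', hU', V', hV', rfl⟩, hf a b U' V'⟩

/-- Conjugation gives one of finitely many self-maps of the finite Pauli group. If `U` and `V`
induce the same map, `V† U` commutes with all Pauli operators and is therefore a scalar, so one
representative per map suffices. -/
theorem finiteUpToScalar_cliffordGroup (ι : Type) [Fintype ι] [DecidableEq ι] :
    FiniteUpToScalar (cliffordGroup ι) := by
  classical
  have : Finite (pauliGroup ι) := pauliGroup_finite.to_subtype
  let f : cliffordGroup ι → pauliGroup ι → pauliGroup ι := fun U P =>
    ⟨U.1 * P.1 * U.1.conjTranspose, U.2.2.subset ⟨P.1, P.2, rfl⟩⟩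
  let r : Set.range f → Matrix (ι → Fin 2) (ι → Fin 2) ℂ := fun a => (Classical.choose a.2).1
  refine ⟨Set.range r, Set.finite_range r, fun U hU => ?_⟩
  let a : Set.range f := ⟨f ⟨U, hU⟩, ⟨U, hU⟩, rfl⟩
  have hV : f (Classical.choose a.2) = f ⟨U, hU⟩ := Classical.choose_spec a.2
  set V := Classical.choose a.2 with hVdef
  have hVV : V.1 * V.1.conjTranspose = 1 := by
    have := Matrix.mem_unitaryGroup_iff.1 V.2.1
    rwa [Matrix.star_eq_conjTranspose] at this
  have hVV' : V.1.conjTranspose * V.1 = 1 := by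
    have := Matrix.mem_unitaryGroup_iff'.1 V.2.1
    rwa [Matrix.star_eq_conjTranspose] at this
  have hUU' : U.conjTranspose * U = 1 := by
    have := Matrix.mem_unitaryGroup_iff'.1 hU.1
    rwa [Matrix.star_eq_conjTranspose] at this
  have hcomm : ∀ P ∈ pauliGroup ι,
      (V.1.conjTranspose * U) * P = P * (V.1.conjTranspose * U) := by
    intro P hP
    have h1 : V.1 * P * V.1.conjTranspose = U * P * U.conjTranspose :=
      congrArg Subtype.val (congrFun hV ⟨P, hP⟩)
    calc (V.1.conjTranspose * U) * P
        = V.1.conjTranspose * (U * P * U.conjTranspose) * U := by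
          simp only [Matrix.mul_assoc, hUU', Matrix.mul_one]
      _ = V.1.conjTranspose * (V.1 * P * V.1.conjTranspose) * U := by rw [h1]
      _ = (V.1.conjTranspose * V.1) * (P * (V.1.conjTranspose * U)) := by
          simp only [Matrix.mul_assoc]
      _ = P * (V.1.conjTranspose * U) := by rw [hVV', Matrix.one_mul]
  obtain ⟨c, hc⟩ := eq_smul_one_of_commute hcomm
  refine ⟨c, V.1, ⟨a, rfl⟩, ?_⟩
  calc U = (V.1 * V.1.conjTranspose) * U := by rw [hVV, Matrix.one_mul]
    _ = V.1 * (V.1.conjTranspose * U) := by rw [Matrix.mul_assoc]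
    _ = c • V.1 := by rw [hc, Matrix.mul_smul, Matrix.mul_one]

end FiniteUpToScalar

/-- The single-qubit Clifford operators, as `2 × 2` matrices. -/
def localClifford : Set (Matrix (Fin 2) (Fin 2) ℂ) :=
  {C | tensor (fun _ : Fin 1 => C) ∈ cliffordGroup (Fin 1)}

/-- A matrix indexed by `Fin 1 → Fin 2` as a `2 × 2` matrix. -/
def toLocal (U : Matrix (Fin 1 → Fin 2) (Fin 1 → Fin 2) ℂ) : Matrix (Fin 2) (Fin 2) ℂ :=
  Matrix.of fun a b => U (fun _ => a) fun _ => b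

theorem tensor_toLocal (U : Matrix (Fin 1 → Fin 2) (Fin 1 → Fin 2) ℂ) :
    tensor (fun _ : Fin 1 => toLocal U) = U := by
  ext x y
  have hx : (fun _ => x 0) = x := by funext i; rw [Subsingleton.elim i 0]
  have hy : (fun _ => y 0) = y := by funext i; rw [Subsingleton.elim i 0]
  simp [tensor, toLocal, hx, hy]

theorem toLocal_tensor (C : Matrix (Fin 2) (Fin 2) ℂ) :
    toLocal (tensor fun _ : Fin 1 => C) = C := by
  ext a b
  simp [tensor, toLocal]

theorem one_mem_localClifford : 1 ∈ localClifford := by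
  rw [localClifford, Set.mem_ofPred_eq, tensor_one]
  exact one_mem_cliffordGroup

theorem mul_mem_localClifford {C D : Matrix (Fin 2) (Fin 2) ℂ} (hC : C ∈ localClifford)
    (hD : D ∈ localClifford) : C * D ∈ localClifford := by
  have := mul_mem_cliffordGroup hC hD
  rwa [tensor_mul] at this

theorem toLocal_mem_localClifford {U : Matrix (Fin 1 → Fin 2) (Fin 1 → Fin 2) ℂ}
    (hU : U ∈ cliffordGroup (Fin 1)) : toLocal U ∈ localClifford := by
  rw [localClifford, Set.mem_ofPred_eq, tensor_toLocal]
  exact hU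

theorem finiteUpToScalar_localClifford : FiniteUpToScalar localClifford := by
  obtain ⟨F, hF, h⟩ := finiteUpToScalar_cliffordGroup (Fin 1)
  refine ⟨toLocal '' F, hF.image _, fun C hC => ?_⟩
  obtain ⟨c, V, hV, hCV⟩ := h _ hC
  refine ⟨c, toLocal V, ⟨V, hV, rfl⟩, ?_⟩
  rw [← toLocal_tensor C, hCV]
  rfl

/-- Two-qubit Clifford operators preceded by single-qubit ones. -/
def dressedClifford : Set (Matrix (Fin 2 → Fin 2) (Fin 2 → Fin 2) ℂ) :=
  Set.image2 (fun U D => U * D) (cliffordGroup (Fin 2))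
    (Set.image2 (fun C C' => tensor ![C, C']) localClifford localClifford)

theorem finiteUpToScalar_dressedClifford : FiniteUpToScalar dressedClifford := by
  refine (finiteUpToScalar_cliffordGroup (Fin 2)).image2
    (finiteUpToScalar_localClifford.image2 finiteUpToScalar_localClifford _ ?_) _ ?_
  · intro a b C C'
    ext x y
    simp [tensor]
    ring
  · intro a b U V
    rw [Matrix.smul_mul, Matrix.mul_smul, smul_smul]

/-! ### The Hadamard gate and the controlled-`Z` gate -/

/-- The sign `(-1) ^ (a * b)`. -/
def czSign (a b : Fin 2) : ℂ := if a = 1 ∧ b = 1 then -1 else 1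

/-- The Hadamard gate. -/
def hadamard : Matrix (Fin 1 → Fin 2) (Fin 1 → Fin 2) ℂ :=
  ((Real.sqrt 2 : ℝ) : ℂ)⁻¹ • tensor fun _ => !![1, 1; 1, -1]

/-- The controlled-`Z` gate. -/
def controlledZ : Matrix (Fin 2 → Fin 2) (Fin 2 → Fin 2) ℂ :=
  Matrix.diagonal fun x => czSign (x 0) (x 1)

theorem hadamard_mem : hadamard ∈ cliffordGroup (Fin 1) := by
  have hs : ((Real.sqrt 2 : ℝ) : ℂ)⁻¹ * ((Real.sqrt 2 : ℝ) : ℂ)⁻¹ = 2⁻¹ := by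
    rw [← mul_inv, ← Complex.ofReal_mul, Real.mul_self_sqrt (by norm_num)]
    norm_num
  -- The factor `2` cancels the two normalizations `1 / √2`.
  have hconj : ∀ A B : Matrix (Fin 2) (Fin 2) ℂ, ∀ β : ℂ,
      !![1, 1; 1, -1] * A * !![1, 1; 1, -1] = (2 * β) • B →
      hadamard * tensor (fun _ => A) * hadamard = β • tensor fun _ => B := by
    intro A B β h
    rw [hadamard, Matrix.smul_mul, Matrix.smul_mul, Matrix.mul_smul, smul_smul, hs, tensor_mul,
      tensor_mul, h, tensor_smul, smul_smul]
    simp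
  refine mem_cliffordGroup_of_involution ?_ ?_ ?_
  · ext x y
    simp only [hadamard, tensor, Matrix.conjTranspose_apply, Matrix.smul_apply, Matrix.of_apply,
      Finset.univ_unique, Finset.prod_singleton, star_smul, star_inv₀]
    generalize x default = a
    generalize y default = b
    fin_cases a <;> fin_cases b <;> simp
  · have := hconj 1 1 1 (by ext a b; fin_cases a <;> fin_cases b <;> norm_num)
    rwa [tensor_one, Matrix.mul_one, one_smul] at this
  · rintro P ⟨α, hα, h, hh, rfl⟩
    have hconst : h = fun _ => h 0 := by funext i; rw [Subsingleton.elim i 0]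
    rw [Matrix.mul_smul, Matrix.smul_mul, hconst]
    have hneg : -α ∈ ({1, -1, Complex.I, -Complex.I} : Set ℂ) := by
      rcases hα with rfl | rfl | rfl | rfl <;> simp
    rcases hh 0 with h0 | h0 | h0 | h0 <;> rw [h0]
    · rw [hconj 1 1 1 (by ext a b; fin_cases a <;> fin_cases b <;> norm_num)]
      exact ⟨α, hα, fun _ => 1, by simp, by simp⟩
    · rw [hconj pauliX pauliZ 1 (by
        ext a b; fin_cases a <;> fin_cases b <;> norm_num [pauliX, pauliZ])]
      exact ⟨α, hα, fun _ => pauliZ, by simp, by simp⟩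
    · rw [hconj pauliY pauliY (-1) (by
        ext a b; fin_cases a <;> fin_cases b <;> simp [pauliY] <;> ring)]
      exact ⟨-α, hneg, fun _ => pauliY, by simp, by simp⟩
    · rw [hconj pauliZ pauliX 1 (by
        ext a b; fin_cases a <;> fin_cases b <;> norm_num [pauliX, pauliZ])]
      exact ⟨α, hα, fun _ => pauliX, by simp, by simp⟩

theorem smul_mem_pauliGroup {ι : Type} [Fintype ι] {α : ℂ}
    (hα : α ∈ ({1, -1, Complex.I, -Complex.I} : Set ℂ))
    {P : Matrix (ι → Fin 2) (ι → Fin 2) ℂ} (hP : P ∈ pauliGroup ι) : α • P ∈ pauliGroup ι := by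
  obtain ⟨β, hβ, h, hh, rfl⟩ := hP
  refine ⟨α * β, ?_, h, hh, smul_smul _ _ _⟩
  rcases hα with rfl | rfl | rfl | rfl <;> rcases hβ with rfl | rfl | rfl | rfl <;> simp

theorem controlledZ_mem : controlledZ ∈ cliffordGroup (Fin 2) := by
  have hconj : ∀ (h : Fin 2 → Matrix (Fin 2) (Fin 2) ℂ) (A B : Matrix (Fin 2) (Fin 2) ℂ) (β : ℂ),
      A ∈ ({1, pauliX, pauliY, pauliZ} : Set (Matrix (Fin 2) (Fin 2) ℂ)) →
      B ∈ ({1, pauliX, pauliY, pauliZ} : Set (Matrix (Fin 2) (Fin 2) ℂ)) →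
      β ∈ ({1, -1, Complex.I, -Complex.I} : Set ℂ) →
      (∀ a b c d, czSign a b * (h 0 a c * h 1 b d) * czSign c d = β * (A a c * B b d)) →
      controlledZ * tensor h * controlledZ ∈ pauliGroup (Fin 2) := by
    intro h A B β hA hB hβ heq
    refine ⟨β, hβ, ![A, B], by simpa [Fin.forall_fin_two] using ⟨hA, hB⟩, ?_⟩
    ext x y
    rw [controlledZ, Matrix.mul_diagonal, Matrix.diagonal_mul]
    simpa [tensor] using heq (x 0) (x 1) (y 0) (y 1)
  refine mem_cliffordGroup_of_involution ?_ ?_ ?_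
  · rw [controlledZ, Matrix.diagonal_conjTranspose]
    congr 1
    funext x
    simp only [Pi.star_apply, czSign]
    split_ifs <;> simp
  · rw [controlledZ, Matrix.diagonal_mul_diagonal, ← Matrix.diagonal_one]
    congr 1
    funext x
    simp only [czSign]
    split_ifs <;> simp
  · rintro P ⟨α, hα, h, hh, rfl⟩
    rw [Matrix.mul_smul, Matrix.smul_mul]
    refine smul_mem_pauliGroup hα ?_
    -- Sixteen conjugates, for the pairs from I, X, Y, Z in lexicographic order; the sign is
    -- negative only for X ⊗ Y and Y ⊗ X.
    rcases hh 0 with h0 | h0 | h0 | h0 <;> rcases hh 1 with h1 | h1 | h1 | h1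
    on_goal 1 => refine hconj h 1 1 1 (by simp) (by simp) (by simp) ?_
    rotate_left
    on_goal 1 => refine hconj h pauliZ pauliX 1 (by simp) (by simp) (by simp) ?_
    rotate_left
    on_goal 1 => refine hconj h pauliZ pauliY 1 (by simp) (by simp) (by simp) ?_
    rotate_left
    on_goal 1 => refine hconj h 1 pauliZ 1 (by simp) (by simp) (by simp) ?_
    rotate_left
    on_goal 1 => refine hconj h pauliX pauliZ 1 (by simp) (by simp) (by simp) ?_
    rotate_left
    on_goal 1 => refine hconj h pauliY pauliY 1 (by simp) (by simp) (by simp) ?_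
    rotate_left
    on_goal 1 => refine hconj h pauliY pauliX (-1) (by simp) (by simp) (by simp) ?_
    rotate_left
    on_goal 1 => refine hconj h pauliX 1 1 (by simp) (by simp) (by simp) ?_
    rotate_left
    on_goal 1 => refine hconj h pauliY pauliZ 1 (by simp) (by simp) (by simp) ?_
    rotate_left
    on_goal 1 => refine hconj h pauliX pauliY (-1) (by simp) (by simp) (by simp) ?_
    rotate_left
    on_goal 1 => refine hconj h pauliX pauliX 1 (by simp) (by simp) (by simp) ?_
    rotate_left
    on_goal 1 => refine hconj h pauliY 1 1 (by simp) (by simp) (by simp) ?_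
    rotate_left
    on_goal 1 => refine hconj h pauliZ 1 1 (by simp) (by simp) (by simp) ?_
    rotate_left
    on_goal 1 => refine hconj h 1 pauliX 1 (by simp) (by simp) (by simp) ?_
    rotate_left
    on_goal 1 => refine hconj h 1 pauliY 1 (by simp) (by simp) (by simp) ?_
    rotate_left
    on_goal 1 => refine hconj h pauliZ pauliZ 1 (by simp) (by simp) (by simp) ?_
    rotate_left
    all_goals
      rw [h0, h1]
      intro a b c d
      fin_cases a <;> fin_cases b <;> fin_cases c <;> fin_cases d <;>
        simp [czSign, pauliX, pauliY, pauliZ]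

/-! ### Graph states in the computational basis -/

section GraphStates

variable {n : ℕ}

theorem czSign_comm (a b : Fin 2) : czSign a b = czSign b a := by
  simp only [czSign, and_comm]

theorem czSign_one_add_left (a b : Fin 2) : czSign (a + 1) b = czSign 1 b * czSign a b := by
  fin_cases a <;> fin_cases b <;> simp [czSign]

theorem czSign_mul_self (a b : Fin 2) : czSign a b * czSign a b = 1 := by
  simp only [czSign]
  split_ifs <;> simp

/-- The configuration `x` with the value at `v` flipped. -/
def flip (v : Fin n) (x : Fin n → Fin 2) : Fin n → Fin 2 := Function.update x v (x v + 1)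

theorem flip_self (v : Fin n) (x : Fin n → Fin 2) : flip v x v = x v + 1 :=
  Function.update_self v _ x

theorem flip_of_ne {v w : Fin n} (h : w ≠ v) (x : Fin n → Fin 2) : flip v x w = x w :=
  Function.update_of_ne h _ x

open Classical in
theorem stabilizerGenerator_mulVec (G : SimpleGraph (Fin n)) (v : Fin n)
    (φ : (Fin n → Fin 2) → ℂ) (x : Fin n → Fin 2) :
    (stabilizerGenerator G v *ᵥ φ) x =
      (∏ w, if G.Adj v w then czSign 1 (x w) else 1) * φ (flip v x) := by
  rw [Matrix.mulVec, dotProduct, Finset.sum_eq_single (flip v x)]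
  · congr 1
    rw [stabilizerGenerator, tensor, Matrix.of_apply]
    refine Finset.prod_congr rfl fun w _ => ?_
    by_cases hw : w = v
    · subst hw
      rw [if_pos rfl, flip_self, if_neg (G.irrefl)]
      generalize x w = a
      fin_cases a <;> simp [pauliX]
    · rw [if_neg hw, flip_of_ne hw]
      split_ifs
      · generalize x w = a
        fin_cases a <;> simp [pauliZ, czSign]
      · simp
  · intro y _ hy
    obtain ⟨w, hw⟩ := Function.ne_iff.1 hy
    rw [stabilizerGenerator, tensor, Matrix.of_apply,
      Finset.prod_eq_zero (Finset.mem_univ w), zero_mul]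
    by_cases hwv : w = v
    · subst hwv
      rw [flip_self] at hw
      rw [if_pos rfl]
      revert hw
      generalize x w = a
      generalize y w = b
      fin_cases a <;> fin_cases b <;> simp [pauliX]
    · rw [flip_of_ne hwv] at hw
      rw [if_neg hwv]
      revert hw
      generalize x w = a
      generalize y w = b
      split_ifs <;> fin_cases a <;> fin_cases b <;> simp [pauliZ]
  · simp

open Classical in
theorem isGraphState_iff {G : SimpleGraph (Fin n)} {φ : (Fin n → Fin 2) → ℂ} :
    IsGraphState G φ ↔ φ ≠ 0 ∧ ∀ v x,
      (∏ w, if G.Adj v w then czSign 1 (x w) else 1) * φ (flip v x) = φ x := by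
  rw [IsGraphState]
  refine and_congr_right fun _ => forall_congr' fun v => ?_
  rw [funext_iff]
  refine forall_congr' fun x => ?_
  rw [← stabilizerGenerator_mulVec]

theorem IsGraphState.apply_flip_zero {G : SimpleGraph (Fin n)} {φ : (Fin n → Fin 2) → ℂ}
    (h : IsGraphState G φ) (v : Fin n) : φ (flip v 0) = φ 0 := by
  have := (isGraphState_iff.1 h).2 v 0
  rw [Finset.prod_eq_one fun w _ => by simp [czSign], one_mul] at this
  exact this

open Classical in
-- Relative to the amplitude at `0`, amplitudes at weight-two configurations record adjacency; this
-- is how the graph is recovered from any multiple of its state.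
theorem IsGraphState.apply_flip_flip_zero {G : SimpleGraph (Fin n)} {φ : (Fin n → Fin 2) → ℂ}
    (h : IsGraphState G φ) (v w : Fin n) :
    φ (flip v (flip w 0)) = (if G.Adj v w then -1 else 1) * φ 0 := by
  have := (isGraphState_iff.1 h).2 v (flip w 0)
  rw [Finset.prod_eq_single w, flip_self, h.apply_flip_zero] at this
  · rw [← this]
    split_ifs <;> simp [czSign]
  · intro u _ hu
    rw [flip_of_ne hu]
    simp [czSign]
  · simp

/-- Flipping a qubit changes an amplitude only by a sign, so a zero at the origin would spread to
all configurations. -/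
theorem IsGraphState.apply_zero_ne {G : SimpleGraph (Fin n)} {φ : (Fin n → Fin 2) → ℂ}
    (h : IsGraphState G φ) : φ 0 ≠ 0 := by
  classical
  intro h0
  refine h.1 ?_
  have hflip : ∀ x v, φ x = 0 → φ (flip v x) = 0 := by
    intro x v hx
    have := (isGraphState_iff.1 h).2 v x
    rw [hx, mul_eq_zero] at this
    refine this.resolve_left (Finset.prod_ne_zero_iff.2 fun w _ => ?_)
    simp only [czSign]
    split_ifs <;> simp
  funext x
  have : ∀ s : Finset (Fin n), φ (s.piecewise x 0) = 0 := by
    intro s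
    induction s using Finset.induction_on with
    | empty => simpa using h0
    | insert i s hi ih =>
      rw [Finset.piecewise_insert]
      have hval : s.piecewise x 0 i = 0 := by simp [hi]
      by_cases hx : x i = 0
      · rwa [hx, ← hval, Function.update_eq_self]
      · have hx1 : x i = s.piecewise x 0 i + 1 := by
          rw [hval]
          revert hx
          generalize x i = a
          fin_cases a <;> simp
        rw [hx1]
        exact hflip _ i ih
  simpa using this Finset.univ

/-- Proportional graph states belong to the same graph. -/
theorem IsGraphState.graph_eq {G G' : SimpleGraph (Fin n)} {φ φ' θ : (Fin n → Fin 2) → ℂ}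
    {a a' : ℂ} (h : IsGraphState G φ) (h' : IsGraphState G' φ') (ha : φ = a • θ)
    (ha' : φ' = a' • θ) : G = G' := by
  classical
  have h0 := h.apply_zero_ne
  have h0' := h'.apply_zero_ne
  ext v w
  have e := h.apply_flip_flip_zero v w
  have e' := h'.apply_flip_flip_zero v w
  rw [ha, Pi.smul_apply, Pi.smul_apply, smul_eq_mul, smul_eq_mul] at e
  rw [ha', Pi.smul_apply, Pi.smul_apply, smul_eq_mul, smul_eq_mul] at e'
  rw [ha, Pi.smul_apply, smul_eq_mul] at h0
  rw [ha', Pi.smul_apply, smul_eq_mul] at h0'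
  have hθ : θ 0 ≠ 0 := right_ne_zero_of_mul h0
  have e1 : θ (flip v (flip w 0)) = (if G.Adj v w then -1 else 1) * θ 0 :=
    mul_left_cancel₀ (left_ne_zero_of_mul h0) (by rw [e]; ring)
  have e2 : θ (flip v (flip w 0)) = (if G'.Adj v w then -1 else 1) * θ 0 :=
    mul_left_cancel₀ (left_ne_zero_of_mul h0') (by rw [e']; ring)
  have e3 := mul_right_cancel₀ hθ (e1.symm.trans e2)
  split_ifs at e3 with h1 h2 h2
  · simp [h1, h2]
  · norm_num at e3
  · norm_num at e3
  · simp [h1, h2]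

/-- A qubit with a neighbour is not in a product state with the others. -/
theorem IsGraphState.not_product {G : SimpleGraph (Fin n)} {φ : (Fin n → Fin 2) → ℂ}
    (h : IsGraphState G φ) {v w : Fin n} (hvw : G.Adj v w) (f : Fin 2 → ℂ)
    (θ : (Fin n → Fin 2) → ℂ) (hθ : ∀ x, θ (flip v x) = θ x)
    (hφ : ∀ x, φ x = f (x v) * θ x) : False := by
  classical
  have e1 := h.apply_flip_zero v
  have e2 := h.apply_flip_zero w
  have e3 := h.apply_flip_flip_zero v w
  have h0 := h.apply_zero_ne
  rw [if_pos hvw, ← e2] at e3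
  rw [hφ 0] at h0
  rw [hφ (flip v 0), hφ 0, hθ, flip_self] at e1
  -- `f` takes equal values at both basis states, so flipping `v` cannot produce the sign that the
  -- edge `v w` demands.
  have f1 := mul_right_cancel₀ (right_ne_zero_of_mul h0) e1
  rw [hφ, hφ (flip w 0), hθ, flip_self, flip_of_ne hvw.ne, f1] at e3
  have h2 : f ((0 : Fin n → Fin 2) v) * θ (flip w 0) = 0 := by linear_combination e3 / 2
  rw [← flip_of_ne hvw.ne 0, ← hφ, e2] at h2
  exact h.apply_zero_ne h2

end GraphStates

/-! ### Every graph state can be generated -/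

section Preparation

variable {n : ℕ}

/-- An algorithm that generates `|G⟩` from `ψ` gives one that generates it from `|0⟩`. -/
def Reachable (G : SimpleGraph (Fin n)) (ψ : State n) : Prop :=
  ∀ A : Algorithm n n, A.Generates G ψ Finset.univ →
    ∃ B : Algorithm n n, B.Generates G (zeroState n) Finset.univ

/-- Algorithms grow only at the root, so a gate is appended to a preparation by prepending it to the
continuation `A`. -/
theorem Reachable.hadamard {G : SimpleGraph (Fin n)} {ψ : State n} (h : Reachable G ψ)
    (p : Fin 1 ↪ Fin n) : Reachable G (applyGate hadamard p ψ) := fun A hA =>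
  h (.single ⟨_, hadamard_mem⟩ p A) ⟨fun _ => Finset.mem_univ _, hA⟩

theorem Reachable.controlledZ {G : SimpleGraph (Fin n)} {ψ : State n} (h : Reachable G ψ)
    (p : Fin 2 ↪ Fin n) : Reachable G (applyGate controlledZ p ψ) := fun A hA =>
  h (.double ⟨_, controlledZ_mem⟩ p A) ⟨fun _ => Finset.mem_univ _, hA⟩

/-- The qubits of `T` are already in the state `|+⟩`. Qubit `i` is still `|0⟩`, so only the constant
first column of the Hadamard matrix enters. -/
theorem applyGate_hadamard_indicator (c : ℂ) (T : Finset (Fin n)) {i : Fin n} (hi : i ∉ T)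
    (p : Fin 1 ↪ Fin n) (hp : p 0 = i) :
    applyGate hadamard p (fun x => if ∀ j, j ∉ T → x j = 0 then c else 0) =
      fun x => if ∀ j, j ∉ insert i T → x j = 0
        then ((Real.sqrt 2 : ℝ) : ℂ)⁻¹ * c else 0 := by
  have hrange : ∀ j, j ≠ i → j ∉ Set.range p := by
    rintro j hj ⟨k, hk⟩
    rw [Subsingleton.elim k 0, hp] at hk
    exact hj hk.symm
  have hself : ∀ (y : Fin 1 → Fin 2) (x : Fin n → Fin 2), Function.extend p y x i = y 0 := by
    intro y x
    rw [← hp]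
    exact p.injective.extend_apply y x 0
  funext x
  rw [applyGate, Finset.sum_eq_single 0]
  · have hiff : (∀ j, j ∉ T → Function.extend p 0 x j = 0) ↔
        ∀ j, j ∉ insert i T → x j = 0 := by
      constructor
      · intro h j hj
        rw [Finset.mem_insert, not_or] at hj
        have := h j hj.2
        rwa [extend_of_notMem_range p _ _ (hrange j hj.1)] at this
      · intro h j hj
        by_cases hji : j = i
        · rw [hji, hself]; rfl
        · rw [extend_of_notMem_range p _ _ (hrange j hji)]
          exact h j (by simp [hji, hj])
    have hH : GraphStatePrep.hadamard (x ∘ p) 0 = ((Real.sqrt 2 : ℝ) : ℂ)⁻¹ := by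
      have : ∀ a : Fin 2, (!![1, 1; 1, -1] : Matrix (Fin 2) (Fin 2) ℂ) a 0 = 1 := by
        intro a; fin_cases a <;> rfl
      rw [GraphStatePrep.hadamard, Matrix.smul_apply, tensor, Matrix.of_apply,
        Finset.prod_eq_one, smul_eq_mul, mul_one]
      intro k _
      exact this _
    simp only [hiff, hH, mul_ite, mul_zero]
  · intro y _ hy
    rw [if_neg, mul_zero]
    intro h
    refine hy ?_
    funext k
    rw [Subsingleton.elim k 0, ← hself y x]
    exact h i hi
  · simp

theorem exists_reachable_const (G : SimpleGraph (Fin n)) :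
    ∃ c : ℂ, c ≠ 0 ∧ Reachable G fun _ => c := by
  have : ∀ T : Finset (Fin n), ∃ c : ℂ, c ≠ 0 ∧
      Reachable G fun x => if ∀ j, j ∉ T → x j = 0 then c else 0 := by
    intro T
    induction T using Finset.induction_on with
    | empty =>
      refine ⟨1, one_ne_zero, fun A hA => ⟨A, ?_⟩⟩
      convert hA using 1
      funext x
      by_cases hx : x = 0
      · subst hx; simp [zeroState]
      · rw [zeroState, Pi.single_eq_of_ne hx, if_neg]
        exact fun h => hx (funext fun j => h j (by simp))
    | insert i T hi ih =>
      obtain ⟨c, hc, h⟩ := ih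
      let p : Fin 1 ↪ Fin n := ⟨fun _ => i, fun _ _ _ => Subsingleton.elim _ _⟩
      refine ⟨((Real.sqrt 2 : ℝ) : ℂ)⁻¹ * c, by simp [hc], ?_⟩
      rw [← applyGate_hadamard_indicator c T hi p rfl]
      exact h.hadamard p
  obtain ⟨c, hc, h⟩ := this Finset.univ
  exact ⟨c, hc, by simpa using h⟩

theorem applyGate_controlledZ (p : Fin 2 ↪ Fin n) (ψ : State n) :
    applyGate controlledZ p ψ = fun x => czSign (x (p 0)) (x (p 1)) * ψ x := by
  funext x
  rw [applyGate, Finset.sum_eq_single (x ∘ p)]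
  · rw [controlledZ, Matrix.diagonal_apply_eq, ← eq_extend_of_eq_off_range fun _ _ => rfl]
    rfl
  · intro y _ hy
    rw [controlledZ, Matrix.diagonal_apply_ne _ hy.symm, zero_mul]
  · simp

theorem exists_reachable_edges (G : SimpleGraph (Fin n)) (E : Finset (Fin n × Fin n))
    (hE : ∀ e ∈ E, e.1 ≠ e.2) : ∃ c : ℂ, c ≠ 0 ∧
      Reachable G fun x => c * ∏ e ∈ E, czSign (x e.1) (x e.2) := by
  induction E using Finset.induction_on with
  | empty => simpa using exists_reachable_const G
  | insert e E he ih =>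
    obtain ⟨c, hc, h⟩ := ih fun e' he' => hE e' (Finset.mem_insert_of_mem he')
    have hne := hE e (Finset.mem_insert_self e E)
    let p : Fin 2 ↪ Fin n := ⟨![e.1, e.2], by
      intro i j hij
      fin_cases i <;> fin_cases j <;> simp_all⟩
    refine ⟨c, hc, ?_⟩
    have := h.controlledZ p
    rw [applyGate_controlledZ] at this
    convert this using 2 with x
    rw [Finset.prod_insert he]
    change c * (czSign (x (p 0)) (x (p 1)) * _) = _
    ring

open Classical in
-- Flipping `v` multiplies the product by `czSign 1 (x w)` for each neighbour `w`, which the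
-- stabilizer's own sign cancels. The condition `e.1 < e.2` counts each edge once; neighbours above
-- and below `v` are collected separately.
theorem isGraphState_edges (G : SimpleGraph (Fin n)) {c : ℂ} (hc : c ≠ 0) :
    IsGraphState G fun x => c *
      ∏ e ∈ Finset.univ.filter (fun e : Fin n × Fin n => e.1 < e.2 ∧ G.Adj e.1 e.2),
        czSign (x e.1) (x e.2) := by
  refine isGraphState_iff.2 ⟨fun h => hc ?_, fun v x => ?_⟩
  · have := congrFun h 0
    simpa [czSign] using this
  · set E := Finset.univ.filter (fun e : Fin n × Fin n => e.1 < e.2 ∧ G.Adj e.1 e.2) with hEdef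
    have hterm : ∀ e ∈ E, czSign (flip v x e.1) (flip v x e.2) =
        ((if e.1 = v then czSign 1 (x e.2) else 1) * (if e.2 = v then czSign 1 (x e.1) else 1)) *
          czSign (x e.1) (x e.2) := by
      intro e he
      have hlt : e.1 < e.2 := (Finset.mem_filter.1 he).2.1
      by_cases h1 : e.1 = v
      · have h2 : e.2 ≠ v := fun h2 => hlt.ne (h1.trans h2.symm)
        rw [if_pos h1, if_neg h2, h1, flip_self, flip_of_ne h2, czSign_one_add_left, mul_one]
      · by_cases h2 : e.2 = v
        · rw [if_neg h1, if_pos h2, h2, flip_self, flip_of_ne h1, czSign_comm,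
            czSign_one_add_left, one_mul, czSign_comm (x v)]
        · rw [if_neg h1, if_neg h2, flip_of_ne h1, flip_of_ne h2, one_mul, one_mul]
    have hleft : ∏ e ∈ E, (if e.1 = v then czSign 1 (x e.2) else 1) =
        ∏ w, if v < w ∧ G.Adj v w then czSign 1 (x w) else 1 := by
      rw [hEdef, Finset.prod_filter, ← Finset.univ_product_univ, Finset.prod_product,
        Finset.prod_eq_single v]
      · simp
      · intro u _ hu
        exact Finset.prod_eq_one fun w _ => by simp [hu]
      · simp
    have hright : ∏ e ∈ E, (if e.2 = v then czSign 1 (x e.1) else 1) =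
        ∏ w, if w < v ∧ G.Adj v w then czSign 1 (x w) else 1 := by
      rw [hEdef, Finset.prod_filter, ← Finset.univ_product_univ, Finset.prod_product_right,
        Finset.prod_eq_single v]
      · simp [G.adj_comm]
      · intro u _ hu
        exact Finset.prod_eq_one fun w _ => by simp [hu]
      · simp
    have hsign : (∏ w, if v < w ∧ G.Adj v w then czSign 1 (x w) else 1) *
        (∏ w, if w < v ∧ G.Adj v w then czSign 1 (x w) else 1) =
        ∏ w, if G.Adj v w then czSign 1 (x w) else 1 := by
      rw [← Finset.prod_mul_distrib]
      refine Finset.prod_congr rfl fun w _ => ?_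
      by_cases hvw : G.Adj v w
      · rcases lt_or_gt_of_ne hvw.ne with h | h
        · simp [h, hvw, h.not_gt]
        · simp [h, hvw, h.not_gt]
      · simp [hvw]
    rw [Finset.prod_congr rfl hterm, Finset.prod_mul_distrib, Finset.prod_mul_distrib, hleft,
      hright, hsign]
    have hsq : (∏ w, if G.Adj v w then czSign 1 (x w) else 1) *
        (∏ w, if G.Adj v w then czSign 1 (x w) else 1) = 1 := by
      rw [← Finset.prod_mul_distrib]
      refine Finset.prod_eq_one fun w _ => ?_
      split_ifs
      · exact czSign_mul_self _ _
      · exact one_mul 1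
    linear_combination (c * ∏ e ∈ E, czSign (x e.1) (x e.2)) * hsq

/-- The complexity of a graph state is attained. -/
theorem exists_algorithm (G : SimpleGraph (Fin n)) : ∃ (s : ℕ) (A : Algorithm n (n + s)),
    A.Generates G (zeroState (n + s)) Finset.univ ∧ A.cost = czComplexity G := by
  classical
  -- Nonemptiness is essential: `sInf ∅ = 0` would come with no algorithm.
  refine Nat.sInf_mem (s := {t | ∃ (s : ℕ) (A : Algorithm n (n + s)),
    A.Generates G (zeroState (n + s)) Finset.univ ∧ A.cost = t}) ?_
  obtain ⟨c, hc, h⟩ := exists_reachable_edges G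
    (Finset.univ.filter fun e : Fin n × Fin n => e.1 < e.2 ∧ G.Adj e.1 e.2)
    fun e he => ((Finset.mem_filter.1 he).2.1).ne
  obtain ⟨B, hB⟩ := h (.output (Function.Embedding.refl _))
    ⟨by simp, _, isGraphState_edges G hc, 0, fun x _ => rfl, fun x hx => absurd (by simp) hx⟩
  exact ⟨B.cost, 0, B, hB, rfl⟩

end Preparation

/-! ### Circuits for the runs of an algorithm -/

section Runs

variable {n q : ℕ}

/-- A list of two-qubit gates of a register indexed by `ι`. -/
abbrev Circuit (ι : Type) : Type :=
  List (Matrix (Fin 2 → Fin 2) (Fin 2 → Fin 2) ℂ × (Fin 2 ↪ ι))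

open Classical in
/-- The part of `ψ` in which the qubits that are not in `live` have the values given by `z`. -/
def restrict (live : Finset (Fin q)) (z : Fin q → Fin 2) (ψ : State q) : State q :=
  fun x => if ∀ i, i ∉ live → x i = z i then ψ x else 0

/-- Gates act only on live qubits, so fixing the measured ones can be postponed to the end. -/
theorem applyGate_restrict {k : ℕ} (U : Matrix (Fin k → Fin 2) (Fin k → Fin 2) ℂ)
    {p : Fin k ↪ Fin q} {live : Finset (Fin q)} (hp : ∀ j, p j ∈ live) (z : Fin q → Fin 2)
    (ψ : State q) :
    applyGate U p (restrict live z ψ) = restrict live z (gate U p ψ) := by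
  funext x
  have hoff : ∀ (y : Fin k → Fin 2) (i : Fin q), i ∉ live → Function.extend p y x i = x i :=
    fun y i hi => extend_of_notMem_range p y x fun ⟨j, hj⟩ => hi (hj ▸ hp j)
  have hiff : ∀ y : Fin k → Fin 2, (∀ i, i ∉ live → Function.extend p y x i = z i) ↔
      ∀ i, i ∉ live → x i = z i := fun y =>
    forall_congr' fun i => forall_congr' fun hi => by rw [hoff y i hi]
  simp only [applyGate, restrict, hiff, gate]
  split_ifs <;> simp

theorem project_restrict {i : Fin q} (b : Fin 2) {live : Finset (Fin q)} (hi : i ∈ live)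
    (z : Fin q → Fin 2) (ψ : State q) :
    project i b (restrict live z ψ) = restrict (live.erase i) (Function.update z i b) ψ := by
  funext x
  have hiff : (∀ j, j ∉ live.erase i → x j = Function.update z i b j) ↔
      x i = b ∧ ∀ j, j ∉ live → x j = z j := by
    constructor
    · intro h
      refine ⟨by simpa using h i (by simp), fun j hj => ?_⟩
      have hji : j ≠ i := fun hji => hj (hji ▸ hi)
      rw [h j fun hj' => hj (Finset.mem_of_mem_erase hj'), Function.update_of_ne hji]
    · rintro ⟨h1, h2⟩ j hj
      by_cases hji : j = i
      · rw [hji, h1, Function.update_self]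
      · rw [Function.update_of_ne hji]
        exact h2 j fun hj' => hj (Finset.mem_erase.2 ⟨hji, hj'⟩)
  simp only [project, restrict, hiff]
  split_ifs <;> simp_all

/-- The state consists of the amplitudes, at measurement outcomes `z`, of a circuit of `k` gates
that is followed by single-qubit Clifford operations. -/
def Simulated (k : ℕ) (ψ : State q) (live : Finset (Fin q)) : Prop :=
  ∃ (l : Circuit (Fin q)) (C : Fin q → Matrix (Fin 2) (Fin 2) ℂ) (z : Fin q → Fin 2),
    (∀ a ∈ l, a.1 ∈ dressedClifford) ∧ (∀ i, C i ∈ localClifford) ∧ l.length = k ∧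
    ψ = restrict live z (tensor C *ᵥ runGates l)

theorem simulated_zeroState : Simulated 0 (zeroState q) Finset.univ := by
  refine ⟨[], fun _ => 1, 0, by simp, fun _ => one_mem_localClifford, rfl, ?_⟩
  rw [tensor_one, Matrix.one_mulVec]
  funext x
  simp [restrict, runGates, zeroState]

theorem Simulated.single {k : ℕ} {ψ : State q} {live : Finset (Fin q)} (h : Simulated k ψ live)
    {U : Matrix (Fin 1 → Fin 2) (Fin 1 → Fin 2) ℂ} (hU : U ∈ cliffordGroup (Fin 1))
    {p : Fin 1 ↪ Fin q} (hp : ∀ j, p j ∈ live) : Simulated k (applyGate U p ψ) live := by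
  obtain ⟨l, C, z, hl, hC, hk, rfl⟩ := h
  refine ⟨l, fun i => Function.extend p (fun _ => toLocal U) 1 i * C i, z, hl, fun i => ?_, hk, ?_⟩
  · refine mul_mem_localClifford ?_ (hC i)
    by_cases hi : i ∈ Set.range p
    · obtain ⟨j, rfl⟩ := hi
      rw [p.injective.extend_apply]
      exact toLocal_mem_localClifford hU
    · rw [extend_of_notMem_range _ _ _ hi]
      exact one_mem_localClifford
  · rw [applyGate_restrict U hp, ← gate_tensor, tensor_toLocal]

theorem Simulated.double {k : ℕ} {ψ : State q} {live : Finset (Fin q)} (h : Simulated k ψ live)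
    {U : Matrix (Fin 2 → Fin 2) (Fin 2 → Fin 2) ℂ} (hU : U ∈ cliffordGroup (Fin 2))
    {p : Fin 2 ↪ Fin q} (hp : ∀ j, p j ∈ live) : Simulated (k + 1) (applyGate U p ψ) live := by
  obtain ⟨l, C, z, hl, hC, hk, rfl⟩ := h
  -- The pending local operators on the two qubits move into the gate and are reset to `1`.
  refine ⟨(U * tensor (C ∘ p), p) :: l, Function.extend p 1 C, z, ?_, fun i => ?_, ?_, ?_⟩
  · rintro a (_ | ⟨_, ha⟩)
    · refine ⟨U, hU, _, ⟨C (p 0), hC _, C (p 1), hC _, rfl⟩, ?_⟩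
      congr 2
    · exact hl a ha
  · by_cases hi : i ∈ Set.range p
    · obtain ⟨j, rfl⟩ := hi
      rw [p.injective.extend_apply]
      exact one_mem_localClifford
    · rw [extend_of_notMem_range _ _ _ hi]
      exact hC i
  · rw [List.length_cons, hk]
  · rw [applyGate_restrict U hp, gate_tensor_mulVec, runGates]

theorem Simulated.measure {k : ℕ} {ψ : State q} {live : Finset (Fin q)} (h : Simulated k ψ live)
    {i : Fin q} (hi : i ∈ live) (b : Fin 2) : Simulated k (project i b ψ) (live.erase i) := by
  obtain ⟨l, C, z, hl, hC, hk, rfl⟩ := h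
  exact ⟨l, C, Function.update z i b, hl, hC, hk, project_restrict b hi z _⟩

theorem applyGate_ne_zero {k : ℕ} {U : Matrix (Fin k → Fin 2) (Fin k → Fin 2) ℂ}
    (hU : U ∈ cliffordGroup (Fin k)) (p : Fin k ↪ Fin q) {ψ : State q} (hψ : ψ ≠ 0) :
    applyGate U p ψ ≠ 0 := by
  intro h
  refine hψ ?_
  have h1 : star U * U = 1 := Matrix.mem_unitaryGroup_iff'.1 hU.1
  rw [← gate_one p ψ, ← h1, gate_mul, show gate U p ψ = 0 from h]
  funext x
  simp [gate]

theorem exists_project_ne_zero (i : Fin q) {ψ : State q} (hψ : ψ ≠ 0) :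
    ∃ b, project i b ψ ≠ 0 := by
  obtain ⟨x, hx⟩ := Function.ne_iff.1 hψ
  exact ⟨x i, Function.ne_iff.2 ⟨x, by simpa [project] using hx⟩⟩

/-- The graph state is an amplitude pattern of a circuit with at most as many gates as the
complexity of the algorithm. -/
theorem Algorithm.Generates.exists_circuit {G : SimpleGraph (Fin n)} {A : Algorithm n q} :
    ∀ {k : ℕ} {ψ : State q} {live : Finset (Fin q)}, Simulated k ψ live → ψ ≠ 0 →
      A.Generates G ψ live →
      ∃ (φ : (Fin n → Fin 2) → ℂ) (e : Fin n ↪ Fin q) (l : Circuit (Fin q))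
        (C : Fin q → Matrix (Fin 2) (Fin 2) ℂ) (z : Fin q → Fin 2),
        IsGraphState G φ ∧ (∀ a ∈ l, a.1 ∈ dressedClifford) ∧ (∀ i, C i ∈ localClifford) ∧
        l.length ≤ k + A.cost ∧
        ∀ y, φ y = (tensor C *ᵥ runGates l) (Function.extend e y z) := by
  induction A with
  | output e =>
    rintro k ψ live ⟨l, C, z, hl, hC, hk, rfl⟩ _ ⟨hlive, φ, hφ, z', hz', -⟩
    refine ⟨φ, e, l, C, z, hφ, hl, hC, by omega, ?_⟩
    have hoff : ∀ (y : Fin n → Fin 2) (w : Fin q → Fin 2) (i : Fin q), i ∉ live →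
        Function.extend e y w i = w i := fun y w i hi =>
      extend_of_notMem_range e y w fun hi' => hi ((hlive i).2 hi')
    -- Both assignments describe the same nonzero state, so they agree on the measured qubits.
    have hzz : ∀ i, i ∉ live → z' i = z i := by
      obtain ⟨y, hy⟩ := Function.ne_iff.1 hφ.1
      have h1 := hz' (Function.extend e y z') (hoff y z')
      rw [extend_comp_embedding, restrict] at h1
      split_ifs at h1 with h2
      · intro i hi
        rw [← h2 i hi, hoff y z' i hi]
      · exact absurd h1.symm hy
    intro y
    have h1 := hz' (Function.extend e y z) fun i hi => by rw [hoff y z i hi, hzz i hi]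
    rw [extend_comp_embedding, restrict, if_pos (hoff y z)] at h1
    exact h1.symm
  | single U p next ih =>
    intro k ψ live h hψ hA
    exact ih (h.single U.2 hA.1) (applyGate_ne_zero U.2 p hψ) hA.2
  | double U p next ih =>
    intro k ψ live h hψ hA
    obtain ⟨φ, e, l, C, z, hφ, hl, hC, hk, hy⟩ :=
      ih (h.double U.2 hA.1) (applyGate_ne_zero U.2 p hψ) hA.2
    refine ⟨φ, e, l, C, z, hφ, hl, hC, ?_, hy⟩
    rw [Algorithm.cost]
    omega
  | measure i next ih =>
    intro k ψ live h hψ hA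
    -- One outcome of positive probability is enough, and its cost is at most the maximum.
    obtain ⟨b, hb⟩ := exists_project_ne_zero i hψ
    obtain ⟨φ, e, l, C, z, hφ, hl, hC, hk, hy⟩ := ih b (h.measure hA.1 b) hb (hA.2 b hb)
    refine ⟨φ, e, l, C, z, hφ, hl, hC, hk.trans (Nat.add_le_add_left ?_ k), hy⟩
    rw [Algorithm.cost]
    fin_cases b
    · exact le_max_left _ _
    · exact le_max_right _ _

theorem exists_circuit (G : SimpleGraph (Fin n)) :
    ∃ (q : ℕ) (φ : (Fin n → Fin 2) → ℂ) (e : Fin n ↪ Fin q) (l : Circuit (Fin q))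
      (C : Fin q → Matrix (Fin 2) (Fin 2) ℂ) (z : Fin q → Fin 2),
      IsGraphState G φ ∧ (∀ a ∈ l, a.1 ∈ dressedClifford) ∧ (∀ i, C i ∈ localClifford) ∧
      l.length ≤ czComplexity G ∧
      ∀ y, φ y = (tensor C *ᵥ runGates l) (Function.extend e y z) := by
  obtain ⟨s, A, hA, hcost⟩ := exists_algorithm G
  have hne : zeroState (n + s) ≠ 0 := Function.ne_iff.2 ⟨0, by simp [zeroState]⟩
  obtain ⟨φ, e, l, C, z, hφ, hl, hC, hk, hy⟩ := hA.exists_circuit simulated_zeroState hne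
  exact ⟨n + s, φ, e, l, C, z, hφ, hl, hC, by omega, hy⟩

theorem exists_touched (l : Circuit (Fin q)) :
    ∃ T : Finset (Fin q), T.card ≤ 2 * l.length ∧ ∀ a ∈ l, ∀ j, a.2 j ∈ T := by
  induction l with
  | nil => exact ⟨∅, by simp, by simp⟩
  | cons a l ih =>
    obtain ⟨T, hT, h⟩ := ih
    refine ⟨{a.2 0, a.2 1} ∪ T, ?_, ?_⟩
    · have h1 := Finset.card_union_le {a.2 0, a.2 1} T
      have h2 := Finset.card_le_two (a := a.2 0) (b := a.2 1)
      rw [List.length_cons]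
      omega
    · rintro b (_ | ⟨_, hb⟩) j
      · fin_cases j <;> simp
      · exact Finset.mem_union_right _ (h b hb j)

theorem extend_flip (e : Fin n ↪ Fin q) (v : Fin n) (y : Fin n → Fin 2) (z : Fin q → Fin 2)
    {i : Fin q} (hi : i ≠ e v) :
    Function.extend e (flip v y) z i = Function.extend e y z i := by
  by_cases h : i ∈ Set.range e
  · obtain ⟨w, rfl⟩ := h
    rw [e.injective.extend_apply, e.injective.extend_apply,
      flip_of_ne fun hw => hi (congrArg e hw)]
  · rw [extend_of_notMem_range _ _ _ h, extend_of_notMem_range _ _ _ h]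

/-- Every vertex with a neighbour is touched by a two-qubit gate. -/
theorem le_two_mul_czComplexity {G : SimpleGraph (Fin n)} (hG : ∀ v, ∃ w, G.Adj v w) :
    n ≤ 2 * czComplexity G := by
  classical
  obtain ⟨q, φ, e, l, C, z, hφ, -, -, hk, hy⟩ := exists_circuit G
  obtain ⟨T, hT, hlT⟩ := exists_touched l
  suffices h : ∀ v, e v ∈ T by
    have h1 : (Finset.univ.map e).card ≤ T.card :=
      Finset.card_le_card fun i hi => by
        obtain ⟨v, -, rfl⟩ := Finset.mem_map.1 hi
        exact h v
    rw [Finset.card_map, Finset.card_univ, Fintype.card_fin] at h1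
    omega
  intro v
  by_contra hv
  obtain ⟨w, hvw⟩ := hG v
  let g : {i // i ∈ T} ↪ Fin q := Function.Embedding.subtype _
  obtain ⟨l', hl'⟩ := exists_map_eq g l fun a ha j => ⟨⟨a.2 j, hlT a ha j⟩, rfl⟩
  have hmem : e v ∈ Finset.univ.filter (fun i => ¬ ∃ j, g j = i) := by
    refine Finset.mem_filter.2 ⟨Finset.mem_univ _, ?_⟩
    rintro ⟨j, hj⟩
    exact hv (hj ▸ j.2)
  -- If no gate touches `e v`, its amplitude `C (e v) b 0` factors out, and the rest does not depend
  -- on the value at `v`.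
  refine hφ.not_product hvw (fun b => C (e v) b 0)
    (fun y => (∏ i ∈ (Finset.univ.filter (fun i => ¬ ∃ j, g j = i)).erase (e v),
      C i (Function.extend e y z i) 0) *
        (tensor (C ∘ g) *ᵥ runGates l') (Function.extend e y z ∘ g)) ?_ ?_
  · intro y
    have h1 : Function.extend e (flip v y) z ∘ g = Function.extend e y z ∘ g := by
      funext j
      exact extend_flip e v y z fun hj => hv (hj ▸ j.2)
    simp only [h1]
    congr 1
    refine Finset.prod_congr rfl fun i hi => ?_
    rw [extend_flip e v y z (Finset.ne_of_mem_erase hi)]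
  · intro y
    rw [hy y, ← hl', runGates_map, tensor_mulVec_pad, ← Finset.mul_prod_erase _ _ hmem,
      e.injective.extend_apply, mul_assoc]

/-- Only the output qubits and the qubits touched by two-qubit gates are needed. -/
theorem exists_small_circuit (G : SimpleGraph (Fin n)) :
    ∃ (m : ℕ) (φ : (Fin n → Fin 2) → ℂ) (l : Circuit (Fin n ⊕ Fin m))
      (C : Fin n ⊕ Fin m → Matrix (Fin 2) (Fin 2) ℂ) (z : Fin m → Fin 2) (a : ℂ),
      m ≤ 2 * czComplexity G ∧
      IsGraphState G φ ∧ (∀ a ∈ l, a.1 ∈ dressedClifford) ∧ (∀ i, C i ∈ localClifford) ∧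
      l.length ≤ czComplexity G ∧
      φ = a • fun y => (tensor C *ᵥ runGates l) (Sum.elim y z) := by
  classical
  obtain ⟨q, φ, e, l, C, z, hφ, hl, hC, hk, hy⟩ := exists_circuit G
  obtain ⟨T, hT, hlT⟩ := exists_touched l
  -- The ancillas to keep: touched qubits that are not outputs.
  let T' := T \ Finset.univ.map e
  let f : Fin T'.card ↪ Fin q := T'.equivFin.symm.toEmbedding.trans (Function.Embedding.subtype _)
  have hf : ∀ j, f j ∉ Set.range e := by
    rintro j ⟨v, hv⟩
    have : f j ∈ T' := (T'.equivFin.symm j).2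
    exact (Finset.mem_sdiff.1 this).2 (hv ▸ Finset.mem_map_of_mem e (Finset.mem_univ v))
  let g : Fin n ⊕ Fin T'.card ↪ Fin q := ⟨Sum.elim e f,
    e.injective.sumElim f.injective fun v j h => hf j ⟨v, h⟩⟩
  have hrange : ∀ i ∈ T, i ∈ Set.range g := by
    intro i hi
    by_cases hie : i ∈ Set.range e
    · obtain ⟨v, rfl⟩ := hie
      exact ⟨Sum.inl v, rfl⟩
    · have hi' : i ∈ T' := Finset.mem_sdiff.2 ⟨hi, fun h => hie (by simpa using h)⟩
      refine ⟨Sum.inr (T'.equivFin ⟨i, hi'⟩), ?_⟩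
      change (T'.equivFin.symm (T'.equivFin ⟨i, hi'⟩)).1 = i
      rw [Equiv.symm_apply_apply]
  obtain ⟨l', hl'⟩ := exists_map_eq g l fun a ha j => hrange _ (hlT a ha j)
  refine ⟨T'.card, φ, l', C ∘ g, z ∘ f,
    ∏ i ∈ Finset.univ.filter (fun i => ¬ ∃ j, g j = i), C i (z i) 0, ?_, hφ, ?_, fun i => hC _,
    ?_, ?_⟩
  · have : T'.card ≤ T.card := Finset.card_le_card Finset.sdiff_subset
    omega
  · intro a ha
    exact hl (a.1, a.2.trans g) (hl' ▸ List.mem_map_of_mem (f := fun a => (a.1, a.2.trans g)) ha)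
  · rw [← hl', List.length_map] at hk
    exact hk
  · funext y
    have h1 : Function.extend e y z ∘ g = Sum.elim y (z ∘ f) := by
      funext i
      rcases i with v | j
      · exact e.injective.extend_apply y z v
      · exact extend_of_notMem_range e y z (hf j)
    rw [hy y, ← hl', runGates_map, tensor_mulVec_pad, h1]
    rw [Pi.smul_apply, smul_eq_mul]
    congr 1
    refine Finset.prod_congr rfl fun i hi => ?_
    rw [extend_of_notMem_range]
    rintro ⟨v, hv⟩
    exact (Finset.mem_filter.1 hi).2 ⟨Sum.inl v, hv⟩

theorem exists_normalized_circuit {ι : Type} [Fintype ι] [DecidableEq ι]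
    {F : Set (Matrix (Fin 2 → Fin 2) (Fin 2 → Fin 2) ℂ)}
    (hF : ∀ U ∈ dressedClifford, ∃ c : ℂ, ∃ V ∈ F, U = c • V) (l : Circuit ι)
    (hl : ∀ a ∈ l, a.1 ∈ dressedClifford) :
    ∃ (l' : List (F × (Fin 2 ↪ ι))) (c : ℂ), l'.length = l.length ∧
      runGates l = c • runGates (l'.map fun a => (a.1.1, a.2)) := by
  induction l with
  | nil => exact ⟨[], 1, rfl, (one_smul _ _).symm⟩
  | cons a l ih =>
    obtain ⟨l', c, hlen, h⟩ := ih fun b hb => hl b (List.mem_cons_of_mem a hb)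
    obtain ⟨d, V, hV, hd⟩ := hF a.1 (hl a List.mem_cons_self)
    refine ⟨(⟨V, hV⟩, a.2) :: l', d * c, by simp [hlen], ?_⟩
    rw [runGates, h, hd, gate_smul]
    rfl

/-- Descriptions of circuits with at most `t` gates from `F`, single-qubit operations from `F'`,
and measurement outcomes. -/
abbrev Code (F : Set (Matrix (Fin 2 → Fin 2) (Fin 2 → Fin 2) ℂ))
    (F' : Set (Matrix (Fin 2) (Fin 2) ℂ)) (n t : ℕ) : Type :=
  Σ m : Fin (2 * t + 1), Σ k : Fin (t + 1), List.Vector (F × (Fin 2 ↪ Fin n ⊕ Fin m)) k ×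
    (Fin n ⊕ Fin m → F') × (Fin m → Fin 2)

/-- The amplitudes described by a code. -/
def Code.decode {F : Set (Matrix (Fin 2 → Fin 2) (Fin 2 → Fin 2) ℂ)}
    {F' : Set (Matrix (Fin 2) (Fin 2) ℂ)} {n t : ℕ} (c : Code F F' n t) :
    (Fin n → Fin 2) → ℂ := fun y =>
  (tensor (fun i => (c.2.2.2.1 i).1) *ᵥ
    runGates (c.2.2.1.1.map fun a => (a.1.1, a.2))) (Sum.elim y c.2.2.2.2)

theorem exists_code {F : Set (Matrix (Fin 2 → Fin 2) (Fin 2 → Fin 2) ℂ)}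
    {F' : Set (Matrix (Fin 2) (Fin 2) ℂ)}
    (hF : ∀ U ∈ dressedClifford, ∃ c : ℂ, ∃ V ∈ F, U = c • V)
    (hF' : ∀ U ∈ localClifford, ∃ c : ℂ, ∃ V ∈ F', U = c • V)
    {G : SimpleGraph (Fin n)} {t : ℕ} (ht : czComplexity G ≤ t) :
    ∃ (c : Code F F' n t) (φ : (Fin n → Fin 2) → ℂ) (a : ℂ),
      IsGraphState G φ ∧ φ = a • c.decode := by
  obtain ⟨m, φ, l, C, z, a, hm, hφ, hl, hC, hk, h⟩ := exists_small_circuit G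
  obtain ⟨l', c, hlen, hl'⟩ := exists_normalized_circuit hF l hl
  choose d D hD hCD using fun i => hF' (C i) (hC i)
  refine ⟨⟨⟨m, by omega⟩, ⟨l.length, by omega⟩, ⟨l', hlen⟩, fun i => ⟨D i, hD i⟩, z⟩, φ,
    a * ((∏ i, d i) * c), hφ, ?_⟩
  rw [h, show C = fun i => d i • D i from funext hCD, tensor_smul, hl']
  funext y
  simp only [Pi.smul_apply, Matrix.smul_mulVec, Matrix.mulVec_smul, smul_eq_mul, Code.decode]
  ring

end Runs

/-! ### Rank-width of graphs with a small vertex cover -/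

section RankWidth

/-- The bipartite adjacency matrix factors through the coordinates `A`: a cover vertex in `S`
supplies its row, one outside `S` its column. An edge with both ends in `A` is credited to its end
in `S`, whence the entry `0` in `B`. -/
theorem cutRank_le_card {V : Type} [Fintype V] {G : SimpleGraph V} {A : Finset V}
    (hA : ∀ u v, G.Adj u v → u ∈ A ∨ v ∈ A) (S : Set V) : cutRank G S ≤ A.card := by
  classical
  let B : Matrix S A (ZMod 2) := Matrix.of fun s a =>
    if (a : V) ∈ S then (if (s : V) = a then 1 else 0)
    else if (s : V) ∈ A then 0 else if G.Adj s a then 1 else 0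
  let C : Matrix A (Sᶜ : Set V) (ZMod 2) := Matrix.of fun a t =>
    if (a : V) ∈ S then (if G.Adj a t then 1 else 0) else if (a : V) = t then 1 else 0
  have hM : (Matrix.of fun (s : S) (t : (Sᶜ : Set V)) =>
      if G.Adj s t then (1 : ZMod 2) else 0) = B * C := by
    ext s t
    rw [Matrix.mul_apply, Matrix.of_apply]
    by_cases hs : (s : V) ∈ A
    · rw [Finset.sum_eq_single ⟨s, hs⟩]
      · simp [B, C]
      · intro a _ ha
        have hne : (s : V) ≠ a := fun h => ha (Subtype.ext h.symm)
        simp [B, hs, hne]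
      · simp
    · by_cases ht : (t : V) ∈ A
      · rw [Finset.sum_eq_single ⟨t, ht⟩]
        · have htS : (t : V) ∉ S := t.2
          simp [B, C, hs, htS]
        · intro a _ ha
          have hne : (a : V) ≠ t := fun h => ha (Subtype.ext h)
          have hne' : (s : V) ≠ a := fun h => hs (h ▸ a.2)
          by_cases haS : (a : V) ∈ S <;> simp [B, C, haS, hne, hne']
        · simp
      · rw [if_neg fun h => (hA _ _ h).elim hs ht]
        symm
        refine Finset.sum_eq_zero fun a _ => ?_
        have hne : (a : V) ≠ t := fun h => ht (h ▸ a.2)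
        have hne' : (s : V) ≠ a := fun h => hs (h ▸ a.2)
        by_cases haS : (a : V) ∈ S <;> simp [B, C, haS, hne, hne']
  have h1 : cutRank G S = (B * C).rank := by
    rw [← hM, cutRank]
  rw [h1]
  refine (Matrix.rank_mul_le_left B C).trans ((Matrix.rank_le_card_width B).trans ?_)
  simp

/-- The parent of a vertex of the caterpillar with spine `0, …, n - 1` and a leaf `n + i` attached
to every vertex `i` of the spine. -/
def caterpillarParent (n v : ℕ) : ℕ := if v < n then v - 1 else v - n

/-- The caterpillar with `n` leaves `n, …, 2 * n - 1` attached to the path `0, …, n - 1`. -/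
def caterpillar (n : ℕ) : SimpleGraph (Fin (2 * n)) :=
  SimpleGraph.fromRel fun v w => (w : ℕ) = caterpillarParent n v

theorem caterpillar_adj {n : ℕ} {v w : Fin (2 * n)} : (caterpillar n).Adj v w ↔
    v ≠ w ∧ ((w : ℕ) = caterpillarParent n v ∨ (v : ℕ) = caterpillarParent n w) :=
  SimpleGraph.fromRel_adj _ _ _

theorem caterpillarParent_lt {n v : ℕ} (hn : 0 < n) (hv : 0 < v) : caterpillarParent n v < v := by
  rw [caterpillarParent]
  split_ifs <;> omega

/-- Parents are smaller than children, so every vertex is joined to `0`; each edge comes from a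
nonzero child, so there are at most `2 * n - 1` edges. -/
theorem caterpillar_isTree {n : ℕ} (hn : 0 < n) : (caterpillar n).IsTree := by
  classical
  have hzero : ∀ k (hk : k < 2 * n),
      (caterpillar n).Reachable ⟨0, by omega⟩ ⟨k, hk⟩ := by
    intro k
    induction k using Nat.strong_induction_on with
    | _ k ih =>
      intro hk
      rcases Nat.eq_zero_or_pos k with rfl | hpos
      · exact SimpleGraph.Reachable.refl _
      · have hlt := caterpillarParent_lt hn hpos
        refine (ih _ hlt (by omega)).trans (SimpleGraph.Adj.reachable ?_)
        rw [caterpillar_adj]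
        exact ⟨fun h => hlt.ne (congrArg Fin.val h), Or.inr rfl⟩
  have hconn : (caterpillar n).Connected := by
    have : Nonempty (Fin (2 * n)) := ⟨⟨0, by omega⟩⟩
    exact ⟨fun u v => (hzero u u.2).symm.trans (hzero v v.2)⟩
  refine SimpleGraph.isTree_iff_connected_and_card.2 ⟨hconn, le_antisymm ?_
    hconn.card_vert_le_card_edgeSet_add_one⟩
  let f : Fin (2 * n) → Sym2 (Fin (2 * n)) := fun v =>
    s(v, ⟨caterpillarParent n v, by
      have := v.2
      rw [caterpillarParent]
      split_ifs <;> omega⟩)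
  have hsub : (caterpillar n).edgeSet ⊆
      (((Finset.univ.erase (⟨0, by omega⟩ : Fin (2 * n))).image f : Finset _) :
        Set (Sym2 (Fin (2 * n)))) := by
    intro e
    induction e using Sym2.ind with
    | _ v w =>
      intro h
      rw [SimpleGraph.mem_edgeSet, caterpillar_adj] at h
      obtain ⟨hne, h⟩ := h
      have hkey : ∀ v w : Fin (2 * n), v ≠ w → (w : ℕ) = caterpillarParent n v →
          s(v, w) ∈ (((Finset.univ.erase (⟨0, by omega⟩ : Fin (2 * n))).image f : Finset _) :
            Set (Sym2 (Fin (2 * n)))) := by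
        intro v w hne hw
        rw [Finset.mem_coe, Finset.mem_image]
        refine ⟨v, Finset.mem_erase.2 ⟨?_, Finset.mem_univ _⟩, ?_⟩
        -- By truncated subtraction `0` is its own parent, which gives no edge.
        · rintro rfl
          refine hne (Fin.ext ?_)
          rw [hw, caterpillarParent, if_pos hn]
          rfl
        · have : w = ⟨caterpillarParent n v, hw ▸ w.2⟩ := Fin.ext hw
          rw [this]
      rcases h with h | h
      · exact hkey v w hne h
      · rw [Sym2.eq_swap]
        exact hkey w v hne.symm h
  have hcard := Set.ncard_le_ncard hsub (Finset.finite_toSet _)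
  rw [Set.ncard_coe_finset] at hcard
  have hcard' := hcard.trans Finset.card_image_le
  rw [Finset.card_erase_of_mem (Finset.mem_univ _), Finset.card_univ, Fintype.card_fin] at hcard'
  rw [Nat.card_coe_set_eq, Nat.card_eq_fintype_card, Fintype.card_fin]
  omega

theorem caterpillar_ncard_le {n : ℕ} (v : Fin (2 * n)) :
    ((caterpillar n).neighborSet v).ncard ≤ 3 := by
  classical
  have hsub : Fin.val '' (caterpillar n).neighborSet v ⊆
      (({caterpillarParent n v, (v : ℕ) + 1, (v : ℕ) + n} : Finset ℕ) : Set ℕ) := by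
    rintro _ ⟨w, hw, rfl⟩
    rw [SimpleGraph.mem_neighborSet, caterpillar_adj] at hw
    obtain ⟨hne, h | h⟩ := hw
    · simp [h]
    · have hne' : (v : ℕ) ≠ w := fun h => hne (Fin.ext h)
      rw [caterpillarParent] at h
      simp only [Finset.coe_insert, Finset.coe_singleton, Set.mem_insert_iff,
        Set.mem_singleton_iff]
      split_ifs at h <;> omega
  have h := Set.ncard_le_ncard hsub (Finset.finite_toSet _)
  rw [Set.ncard_image_of_injective _ Fin.val_injective, Set.ncard_coe_finset] at h
  exact h.trans Finset.card_le_three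

theorem caterpillar_ncard_eq_one_iff {n : ℕ} (hn : 2 ≤ n) (v : Fin (2 * n)) :
    ((caterpillar n).neighborSet v).ncard = 1 ↔ n ≤ (v : ℕ) := by
  have hv := v.2
  constructor
  · intro h
    by_contra hlt
    obtain ⟨a, ha⟩ := Set.ncard_eq_one.1 h
    have h1 : (⟨v + n, by omega⟩ : Fin (2 * n)) ∈ (caterpillar n).neighborSet v := by
      rw [SimpleGraph.mem_neighborSet, caterpillar_adj, Ne, Fin.ext_iff]
      simp only [caterpillarParent]
      refine ⟨by omega, Or.inr ?_⟩
      rw [if_neg (by omega)]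
      omega
    rw [ha, Set.mem_singleton_iff] at h1
    -- A spine vertex has, besides its leaf, a spine neighbour: the successor of `0`, or the
    -- predecessor otherwise. For `n = 1` this would fail.
    rcases Nat.eq_zero_or_pos (v : ℕ) with h0 | hpos
    · have h2 : (⟨v + 1, by omega⟩ : Fin (2 * n)) ∈ (caterpillar n).neighborSet v := by
        rw [SimpleGraph.mem_neighborSet, caterpillar_adj, Ne, Fin.ext_iff]
        simp only [caterpillarParent]
        refine ⟨by omega, Or.inr ?_⟩
        rw [if_pos (by omega)]
        omega
      rw [ha, Set.mem_singleton_iff, ← h1, Fin.ext_iff] at h2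
      simp only at h2
      omega
    · have h2 : (⟨v - 1, by omega⟩ : Fin (2 * n)) ∈ (caterpillar n).neighborSet v := by
        rw [SimpleGraph.mem_neighborSet, caterpillar_adj, Ne, Fin.ext_iff]
        simp only [caterpillarParent]
        refine ⟨by omega, Or.inl ?_⟩
        rw [if_pos (by omega)]
      rw [ha, Set.mem_singleton_iff, ← h1, Fin.ext_iff] at h2
      simp only at h2
      omega
  · intro h
    refine Set.ncard_eq_one.2 ⟨⟨v - n, by omega⟩, ?_⟩
    ext w
    have hw := w.2
    rw [SimpleGraph.mem_neighborSet, caterpillar_adj, Set.mem_singleton_iff, Ne, Fin.ext_iff,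
      Fin.ext_iff]
    simp only [caterpillarParent]
    split_ifs <;> omega

/-- The rank-decomposition along the caterpillar. -/
def caterpillarDecomposition {n : ℕ} (hn : 2 ≤ n) : RankDecomposition (Fin n) where
  size := 2 * n
  tree := caterpillar n
  isTree := caterpillar_isTree (by omega)
  two_le_size := by omega
  subcubic := caterpillar_ncard_le
  leaf := Equiv.ofBijective
    (fun i => ⟨⟨n + i, by omega⟩, (caterpillar_ncard_eq_one_iff hn _).2 (Nat.le_add_right n i)⟩) <| by
    constructor
    · intro i j hij
      have h := congrArg (fun w => (w.1 : ℕ)) hij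
      simp only at h
      exact Fin.ext (by omega)
    · rintro ⟨w, hw⟩
      have h := (caterpillar_ncard_eq_one_iff hn w).1 hw
      have h' := w.2
      refine ⟨⟨w - n, by omega⟩, Subtype.ext (Fin.ext ?_)⟩
      simp only
      omega

/-- The bound holds for all cuts, so the caterpillar serves only as some decomposition. -/
theorem rankWidth_le_card {n : ℕ} {G : SimpleGraph (Fin n)} {A : Finset (Fin n)}
    (hA : ∀ u v, G.Adj u v → u ∈ A ∨ v ∈ A) : rankWidth G ≤ A.card := by
  rw [rankWidth]
  split_ifs with h
  · exact Nat.zero_le _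
  · have hn : 2 ≤ n := by rw [Fintype.card_fin] at h; omega
    exact (Nat.sInf_le (Set.mem_range_self (caterpillarDecomposition hn))).trans
      (Finset.sup_le fun _ _ => cutRank_le_card hA _)

end RankWidth

/-! ### Counting -/

section Counting

variable {n : ℕ}

/-- The `+ 1`s keep the bases positive even for empty gate sets, so that exponents can be raised to
their maxima. -/
theorem card_code_le {F : Set (Matrix (Fin 2 → Fin 2) (Fin 2 → Fin 2) ℂ)}
    {F' : Set (Matrix (Fin 2) (Fin 2) ℂ)} [Fintype F] [Fintype F'] (hn : 0 < n) (t : ℕ) :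
    Fintype.card (Code F F' n t) ≤ (2 * t + 1) * ((t + 1) *
      (((Fintype.card F + 1) * (n + 2 * t) ^ 2) ^ t *
        ((Fintype.card F' + 1) ^ (n + 2 * t) * 2 ^ (2 * t)))) := by
  classical
  rw [Fintype.card_sigma]
  refine (Finset.sum_le_card_nsmul _ _ _ fun m _ => ?_).trans_eq
    (by rw [Finset.card_univ, Fintype.card_fin, smul_eq_mul])
  rw [Fintype.card_sigma]
  refine (Finset.sum_le_card_nsmul _ _ _ fun k _ => ?_).trans_eq
    (by rw [Finset.card_univ, Fintype.card_fin, smul_eq_mul])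
  have hm : (m : ℕ) ≤ 2 * t := by omega
  have hk : (k : ℕ) ≤ t := by omega
  have hemb : Fintype.card (Fin 2 ↪ Fin n ⊕ Fin m) ≤ (n + 2 * t) ^ 2 := by
    refine (Fintype.card_le_of_injective (fun p : Fin 2 ↪ Fin n ⊕ Fin m => (p : Fin 2 → _))
      DFunLike.coe_injective).trans ?_
    simp only [Fintype.card_fun, Fintype.card_sum, Fintype.card_fin]
    exact Nat.pow_le_pow_left (by omega) 2
  simp only [Fintype.card_prod, card_vector, Fintype.card_fun, Fintype.card_sum, Fintype.card_fin]
  refine Nat.mul_le_mul ?_ (Nat.mul_le_mul ?_ (Nat.pow_le_pow_right (by norm_num) hm))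
  · refine (Nat.pow_le_pow_left (Nat.mul_le_mul (Nat.le_succ _) hemb) _).trans
      (Nat.pow_le_pow_right ?_ hk)
    positivity
  · exact (Nat.pow_le_pow_left (Nat.le_succ _) _).trans
      (Nat.pow_le_pow_right (Nat.succ_pos _) (by omega))

/-- The graph whose edges are the given pairs. -/
def graphOfPairs (S : Finset (Fin n × Fin n)) : SimpleGraph (Fin n) :=
  SimpleGraph.fromRel fun u v => (u, v) ∈ S

theorem graphOfPairs_cover {A : Finset (Fin n)} {S : Finset (Fin n × Fin n)}
    (hS : S ⊆ A ×ˢ Aᶜ) {u v : Fin n} (h : (graphOfPairs S).Adj u v) : u ∈ A ∨ v ∈ A := by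
  rw [graphOfPairs, SimpleGraph.fromRel_adj] at h
  rcases h.2 with h | h
  · exact Or.inl (Finset.mem_product.1 (hS h)).1
  · exact Or.inr (Finset.mem_product.1 (hS h)).1

/-- Pairs are oriented from `A` to its complement, so `S` can be read off its graph. -/
theorem mem_iff_graphOfPairs {A : Finset (Fin n)} {S : Finset (Fin n × Fin n)}
    (hS : S ⊆ A ×ˢ Aᶜ) (e : Fin n × Fin n) :
    e ∈ S ↔ e ∈ A ×ˢ Aᶜ ∧ (graphOfPairs S).Adj e.1 e.2 := by
  rw [graphOfPairs, SimpleGraph.fromRel_adj]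
  constructor
  · intro h
    have h' := Finset.mem_product.1 (hS h)
    exact ⟨hS h, fun he => Finset.mem_compl.1 h'.2 (he ▸ h'.1), Or.inl h⟩
  · rintro ⟨h, -, h' | h'⟩
    · exact h'
    · exact absurd (Finset.mem_product.1 (hS h')).1
        (Finset.mem_compl.1 (Finset.mem_product.1 h).2)

/-- If all bipartite graphs with a given side of size `r` have complexity at most `t`, then there
are at least as many codes. -/
theorem two_pow_le_card_code {F : Set (Matrix (Fin 2 → Fin 2) (Fin 2 → Fin 2) ℂ)}
    {F' : Set (Matrix (Fin 2) (Fin 2) ℂ)} [Fintype F] [Fintype F']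
    (hF : ∀ U ∈ dressedClifford, ∃ c : ℂ, ∃ V ∈ F, U = c • V)
    (hF' : ∀ U ∈ localClifford, ∃ c : ℂ, ∃ V ∈ F', U = c • V) {t : ℕ} (A : Finset (Fin n))
    (h : ∀ S ⊆ A ×ˢ Aᶜ, czComplexity (graphOfPairs S) ≤ t) :
    2 ^ (A.card * (n - A.card)) ≤ Fintype.card (Code F F' n t) := by
  classical
  choose c φ a hφ hca using fun S : (A ×ˢ Aᶜ).powerset =>
    exists_code hF hF' (h S.1 (Finset.mem_powerset.1 S.2))
  have hinj : Function.Injective c := by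
    intro S S' hSS
    have hG := (hφ S).graph_eq (hφ S') (hca S) (hSS ▸ hca S')
    refine Subtype.ext (Finset.ext fun e => ?_)
    rw [mem_iff_graphOfPairs (Finset.mem_powerset.1 S.2),
      mem_iff_graphOfPairs (Finset.mem_powerset.1 S'.2), hG]
  have hcard := Fintype.card_le_of_injective c hinj
  rwa [Fintype.card_coe, Finset.card_powerset, Finset.card_product, Finset.card_compl,
    Fintype.card_fin] at hcard

/-- Every vertex of the star has a neighbour. -/
theorem exists_star (hn : 2 ≤ n) : ∃ G : SimpleGraph (Fin n),
    rankWidth G ≤ 1 ∧ ∀ v, ∃ w, G.Adj v w := by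
  let o : Fin n := ⟨0, by omega⟩
  have hadj : ∀ u v, (SimpleGraph.fromRel fun u _ : Fin n => u = o).Adj u v ↔
      u ≠ v ∧ (u = o ∨ v = o) := SimpleGraph.fromRel_adj _
  refine ⟨SimpleGraph.fromRel fun u _ => u = o, ?_, fun v => ?_⟩
  · refine (rankWidth_le_card (A := {o}) fun u v h => ?_).trans_eq (Finset.card_singleton o)
    simpa using ((hadj u v).1 h).2
  · by_cases hv : v = o
    · exact ⟨⟨1, by omega⟩, (hadj _ _).2 ⟨by rw [hv]; simp [o, Fin.ext_iff], Or.inl hv⟩⟩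
    · exact ⟨o, (hadj _ _).2 ⟨hv, Or.inr rfl⟩⟩

/-- The logarithm of the number of codes. -/
theorem log_count_le {K L : ℕ} {t : ℕ} (hn : 2 ≤ n) (ht : t ≤ n ^ 2) :
    Real.log (((2 * t + 1) * ((t + 1) * (((K + 1) * (n + 2 * t) ^ 2) ^ t *
        ((L + 1) ^ (n + 2 * t) * 2 ^ (2 * t)))) : ℕ) : ℝ) ≤
      (8 + Real.log (L + 1)) * n +
        (2 * Real.log (K + 1) + 4 * Real.log (L + 1) + 10) * (t * Real.log n) := by
  have hn' : (2 : ℝ) ≤ n := by exact_mod_cast hn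
  have ht' : (t : ℝ) ≤ (n : ℝ) ^ 2 := by exact_mod_cast ht
  have ht0 : (0 : ℝ) ≤ t := Nat.cast_nonneg t
  have hK : 0 ≤ Real.log ((K : ℝ) + 1) := Real.log_nonneg (by simp)
  have hL : 0 ≤ Real.log ((L : ℝ) + 1) := Real.log_nonneg (by simp)
  have hl2 := Real.log_two_gt_d9
  have hl2' := Real.log_two_lt_d9
  have hl : Real.log 2 ≤ Real.log n := Real.log_le_log (by norm_num) hn'
  have hln : Real.log n ≤ n := (Real.log_le_sub_one_of_pos (by linarith)).trans (by linarith)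
  -- Since `t ≤ n ^ 2`, all sizes are polynomial in `n`, and their logarithms are at most `4 * log
  -- n`.
  have hbig : (n : ℝ) + 2 * t ≤ (n : ℝ) ^ 4 := by nlinarith [sq_nonneg ((n : ℝ) - 2)]
  have hbound : ∀ x : ℝ, 0 < x → x ≤ n + 2 * t → Real.log x ≤ 4 * Real.log n := by
    intro x hx hx'
    have := Real.log_le_log hx (hx'.trans hbig)
    rwa [Real.log_pow] at this
  have h1 := hbound (2 * t + 1) (by positivity) (by linarith)
  have h2 := hbound (t + 1) (by positivity) (by linarith)
  have h3 := hbound (n + 2 * t) (by positivity) le_rfl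
  have hpos : (0 : ℝ) < n + 2 * t := by positivity
  push_cast
  rw [Real.log_mul (by positivity) (by positivity), Real.log_mul (by positivity) (by positivity),
    Real.log_mul (by positivity) (by positivity), Real.log_mul (by positivity) (by positivity),
    Real.log_pow, Real.log_pow, Real.log_pow, Real.log_mul (by positivity) (by positivity),
    Real.log_pow]
  push_cast
  set ℓ := Real.log n
  set κ := Real.log ((K : ℝ) + 1)
  set μ := Real.log ((L : ℝ) + 1)
  -- A bare `t` is absorbed into `t * log n` because `2 * log n ≥ 2 * log 2 ≥ 1`.
  have e1 : (t : ℝ) * κ ≤ 2 * κ * (t * ℓ) := by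
    nlinarith [mul_nonneg (mul_nonneg ht0 hK) (show (0 : ℝ) ≤ 2 * ℓ - 1 by linarith)]
  have e2 : (t : ℝ) * (2 * Real.log ((n : ℝ) + 2 * t)) ≤ 8 * (t * ℓ) := by
    nlinarith [mul_nonneg ht0 (sub_nonneg.2 h3)]
  have e3 : 2 * (t : ℝ) * μ ≤ 4 * μ * (t * ℓ) := by
    nlinarith [mul_nonneg (mul_nonneg ht0 hL) (show (0 : ℝ) ≤ 2 * ℓ - 1 by linarith)]
  have e4 : 2 * (t : ℝ) * Real.log 2 ≤ 2 * (t * ℓ) := by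
    nlinarith [mul_nonneg ht0 (sub_nonneg.2 hl)]
  linarith

end Counting

end GraphStatePrep

end

/-! ### Choice of the constants and conclusion -/

theorem lemma1 :
    ∃ c : ℝ, 0 < c ∧ ∀ n : ℕ, 2 ≤ n → ∀ r : ℕ, r ≤ ⌈(n : ℝ) / 3⌉₊ →
      ∃ G : SimpleGraph (Fin n), GraphStatePrep.rankWidth G ≤ r ∧
        c * (r : ℝ) * (n : ℝ) / Real.log (n : ℝ) ≤ (GraphStatePrep.czComplexity G : ℝ) := by
  obtain ⟨F, hFfin, hF⟩ := GraphStatePrep.finiteUpToScalar_dressedClifford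
  obtain ⟨F', hFfin', hF'⟩ := GraphStatePrep.finiteUpToScalar_localClifford
  have := hFfin.fintype
  have := hFfin'.fintype
  set κ := Real.log ((Fintype.card F : ℝ) + 1) with hκdef
  set μ := Real.log ((Fintype.card F' : ℝ) + 1) with hμdef
  have hκ : 0 ≤ κ := Real.log_nonneg (by simp)
  have hμ : 0 ≤ μ := Real.log_nonneg (by simp)
  set D : ℝ := 2 * κ + 4 * μ + 10 with hD
  have hDpos : 10 ≤ D := by linarith
  -- Threshold for `r` beyond which the linear term `(8 + μ) * n` of the count is at most `r * n /
  -- 8`.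
  set R : ℝ := 8 * (8 + μ) with hR
  have hRpos : 64 ≤ R := by linarith
  -- The first bound caps the `t * log n` term of the count at `r * n / 16`; the second makes the
  -- star suffice when `r < R`.
  set c : ℝ := min (1 / (16 * D)) (1 / (4 * R)) with hc
  have hc0 : 0 < c := lt_min (by positivity) (by positivity)
  have hcD : 16 * (c * D) ≤ 1 := by
    have := (le_div_iff₀ (by positivity)).1 (min_le_left (1 / (16 * D)) (1 / (4 * R)))
    linarith
  have hcR : 4 * (c * R) ≤ 1 := by
    have := (le_div_iff₀ (by positivity)).1 (min_le_right (1 / (16 * D)) (1 / (4 * R)))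
    linarith
  refine ⟨c, hc0, fun n hn r hr => ?_⟩
  have hn' : (2 : ℝ) ≤ n := by exact_mod_cast hn
  have hl2 := Real.log_two_gt_d9
  have hl : 1 / 2 ≤ Real.log n :=
    (by linarith : (1 : ℝ) / 2 ≤ Real.log 2).trans (Real.log_le_log (by norm_num) hn')
  have hlpos : 0 < Real.log n := by linarith
  -- This gives `n - r ≥ n / 2`. Rounding up is harmless because `n ≥ 2`.
  have hr2 : 2 * r ≤ n := by
    have h1 : (⌈(n : ℝ) / 3⌉₊ : ℝ) < n / 3 + 1 := Nat.ceil_lt_add_one (by positivity)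
    have h2 : (r : ℝ) < n / 3 + 1 := lt_of_le_of_lt (by exact_mod_cast hr) h1
    have h3 : 3 * r < n + 3 := by
      have : (3 * r : ℝ) < n + 3 := by linarith
      exact_mod_cast this
    omega
  obtain ⟨A, -, hA⟩ := Finset.exists_subset_card_eq
    (s := (Finset.univ : Finset (Fin n))) (n := r) (by simp; omega)
  by_cases hr0 : r = 0
  · refine ⟨GraphStatePrep.graphOfPairs ∅, ?_, ?_⟩
    · rw [← hA]
      exact GraphStatePrep.rankWidth_le_card fun u v =>
        GraphStatePrep.graphOfPairs_cover (Finset.empty_subset _)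
    · simp [hr0]
  have hrpos : (1 : ℝ) ≤ r := by exact_mod_cast Nat.one_le_iff_ne_zero.2 hr0
  by_cases hrR : (r : ℝ) < R
  · obtain ⟨G, hG, hadj⟩ := GraphStatePrep.exists_star hn
    refine ⟨G, hG.trans (Nat.one_le_iff_ne_zero.2 hr0), ?_⟩
    have h1 : (n : ℝ) ≤ 2 * GraphStatePrep.czComplexity G := by
      exact_mod_cast GraphStatePrep.le_two_mul_czComplexity hadj
    rw [div_le_iff₀ hlpos]
    have h2 : c * r ≤ c * R := mul_le_mul_of_nonneg_left hrR.le hc0.le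
    have h3 : c * r * n ≤ 1 / 4 * n := mul_le_mul_of_nonneg_right (by linarith) (by linarith)
    have h4 : (n : ℝ) / 2 * (1 / 2) ≤ GraphStatePrep.czComplexity G * Real.log n :=
      mul_le_mul (by linarith) hl (by norm_num) (Nat.cast_nonneg _)
    linarith
  push Not at hrR
  by_contra! hcon
  set b : ℝ := c * r * n / Real.log n with hb
  have hb0 : 0 ≤ b := by positivity
  have hbl : b * Real.log n = c * r * n := div_mul_cancel₀ _ hlpos.ne'
  have htb : (⌊b⌋₊ : ℝ) ≤ b := Nat.floor_le hb0
  have hcount := GraphStatePrep.two_pow_le_card_code hF hF' (t := ⌊b⌋₊) A fun S hS => by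
    refine Nat.le_floor (hcon _ ?_).le
    rw [← hA]
    exact GraphStatePrep.rankWidth_le_card fun u v => GraphStatePrep.graphOfPairs_cover hS
  have ht : ⌊b⌋₊ ≤ n ^ 2 := by
    have h1 : b ≤ (n : ℝ) ^ 2 := by
      rw [hb, div_le_iff₀ hlpos]
      have h2 : (r : ℝ) ≤ n := by exact_mod_cast (by omega : r ≤ n)
      have h3 : c ≤ 1 / 2 := by nlinarith
      have h4 : c * r ≤ 1 / 2 * n := mul_le_mul h3 h2 (by positivity) (by norm_num)
      have h5 : c * r * n ≤ 1 / 2 * n * n := mul_le_mul_of_nonneg_right h4 (by linarith)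
      nlinarith [mul_nonneg (sq_nonneg (n : ℝ)) (sub_nonneg.2 hl)]
    have : (⌊b⌋₊ : ℝ) ≤ (n : ℝ) ^ 2 := htb.trans h1
    exact_mod_cast this
  rw [hA] at hcount
  have hcount' := hcount.trans (GraphStatePrep.card_code_le (by omega) _)
  have hlog := (Real.log_le_log (by positivity) (Nat.cast_le (α := ℝ).2 hcount')).trans
    (GraphStatePrep.log_count_le hn ht)
  rw [Nat.cast_pow, Real.log_pow, Nat.cast_mul, Nat.cast_sub (by omega), Nat.cast_ofNat] at hlog
  have hr2' : 2 * (r : ℝ) ≤ n := by exact_mod_cast hr2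
  have hnr : (n : ℝ) / 2 ≤ n - r := by linarith
  have h1 : (r : ℝ) * (n / 2) * (1 / 2) ≤ r * (n - r) * Real.log 2 :=
    mul_le_mul (mul_le_mul_of_nonneg_left hnr (by linarith)) (by linarith) (by norm_num)
      (mul_nonneg (by linarith) (by linarith))
  have h2 : (⌊b⌋₊ : ℝ) * Real.log n ≤ c * r * n := by
    rw [← hbl]
    exact mul_le_mul_of_nonneg_right htb hlpos.le
  have h3 : D * (⌊b⌋₊ * Real.log n) ≤ D * (c * r * n) :=
    mul_le_mul_of_nonneg_left h2 (by linarith)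
  have hrn : (0 : ℝ) < r * n := by positivity
  have h4 : D * (c * r * n) ≤ 1 / 16 * (r * n) := by
    have : D * (c * r * n) = (c * D) * (r * n) := by ring
    rw [this]
    exact mul_le_mul_of_nonneg_right (by linarith) hrn.le
  have h5 : (8 + μ) * n ≤ r * n / 8 := by
    have : R * n ≤ r * n := mul_le_mul_of_nonneg_right hrR (by linarith)
    rw [hR] at this
    linarith
  -- The graphs have log-count at least `r * n / 4`, the codes at most `r * n / 8 + r * n / 16`.
  linarith
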